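/- Let $M$ be a compact oriented Riemannian manifold without boundary, of dimension $m\ge 4$, with volume form $\nu_M$, and let $E$ be a smooth Hermitian vector bundle over $M$. For a connection $A$ on $E$ with curvature $F_A$, the Chern character $ch(E)$ is represented by the closed form $\mathrm{Tr}\exp\left(\frac{i}{2\pi}F_A\right)$. Let $\Phi$ be a smooth closed $(m-4)$-form on $M$ (for instance a Yang–Mills calibrating form, i.e. a closed form which in addition satisfies the pointwise bound $\phi\wedge\phi\wedge\Phi\le|\phi|^2\nu_M$ for all $2$-forms $\phi$; this bound is not needed). A Hermitian connection $D$ on $E$ with curvature $F_D$ is called $\Phi$-calibrated if $$\mathrm{Tr}(F_D\wedge F_D)\wedge\Phi=|F_D|^2\,\nu_M\quad\text{at every point of }M,$$ where $|F_D|^2=\sum_{i<j}\mathrm{Tr}\left(F_D(e_i,e_j)^*F_D(e_i,e_j)\right)$ for an orthonormal frame $(e_i)$ of $TM$. **Proposition.** If $E$ admits a $\Phi$-calibrated connection $D$, then $$\int_M ch(E)\,\Phi\le 0,$$ where $ch(E)$ may be computed from any (complex linear) connection on $E$; in particular the left-hand side is real. Equality holds if and only if $E$ is flat, i.e. admits a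 flat Hermitian connection, and also if and only if the calibrated connection $D$ is itself flat. -/

import Mathlib

open scoped Manifold ContDiff Topology
open Bundle


noncomputable section

/-! ## Differential forms on a manifold -/

/-- The wedge product (normalised as
`(α ∧ β)(v₁, …) = 1 / (k! l!) ∑ σ, sign σ · μ (α (v_σ(1), …)) (β (v_σ(k+1), …))`)
of a `k`-form and an `l`-form on a vector space `T`, with the values multiplied by the
bilinear product `μ`. -/
def wedge {T A B : Type*} (μ : A → B → ℂ) {k l : ℕ} (α : (Fin k → T) → A)
    (β : (Fin l → T) → B) : (Fin (k + l) → T) → ℂ := fun v =>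
  (((k.factorial * l.factorial : ℕ) : ℂ))⁻¹ * ∑ σ : Equiv.Perm (Fin (k + l)),
    ((Equiv.Perm.sign σ : ℤ) : ℂ) *
      μ (α fun i => v (σ (Fin.castAdd l i))) (β fun j => v (σ (Fin.natAdd k j)))

section Forms

variable {m : ℕ} {M : Type*} [TopologicalSpace M] [ChartedSpace (EuclideanSpace ℝ (Fin m)) M]

/-- The pullback of a `k`-form on `M` to the target of the chart around `c`. -/
def formInChart {k : ℕ} (Φ : ∀ x : M, TangentSpace (𝓡 m) x [⋀^Fin k]→L[ℝ] ℝ) (c : M)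
    (z : EuclideanSpace ℝ (Fin m)) : EuclideanSpace ℝ (Fin m) [⋀^Fin k]→L[ℝ] ℝ :=
  (Φ ((extChartAt (𝓡 m) c).symm z)).compContinuousLinearMap
    (mfderiv 𝓘(ℝ, EuclideanSpace ℝ (Fin m)) (𝓡 m) (extChartAt (𝓡 m) c).symm z)

/-- A `k`-form is smooth if it is smooth in the charts. -/
def IsSmoothForm {k : ℕ} (Φ : ∀ x : M, TangentSpace (𝓡 m) x [⋀^Fin k]→L[ℝ] ℝ) : Prop :=
  ∀ c : M, ContDiffOn ℝ ∞ (formInChart Φ c) (extChartAt (𝓡 m) c).target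

/-- A `k`-form is closed, `dΦ = 0`, if its exterior derivative vanishes in the charts. -/
def IsClosedForm {k : ℕ} (Φ : ∀ x : M, TangentSpace (𝓡 m) x [⋀^Fin k]→L[ℝ] ℝ) : Prop :=
  ∀ c : M, ∀ z ∈ (extChartAt (𝓡 m) c).target, extDeriv (formInChart Φ c) z = 0

/-- The coordinate frame `∂₁, …, ∂ₘ` of the chart around `c`, at the point with coordinates `z`. -/
def coordFrame (c : M) (z : EuclideanSpace ℝ (Fin m)) (i : Fin m) :
    TangentSpace (𝓡 m) ((extChartAt (𝓡 m) c).symm z) :=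
  mfderiv 𝓘(ℝ, EuclideanSpace ℝ (Fin m)) (𝓡 m) (extChartAt (𝓡 m) c).symm z
    (EuclideanSpace.single i (1 : ℝ) : EuclideanSpace ℝ (Fin m))

instance tangentFinrankFact (x : M) : Fact (Module.finrank ℝ (TangentSpace (𝓡 m) x) = m) :=
  ⟨finrank_euclideanSpace_fin⟩

instance tangentFiniteDimensional (x : M) : FiniteDimensional ℝ (TangentSpace (𝓡 m) x) :=
  inferInstanceAs (FiniteDimensional ℝ (EuclideanSpace ℝ (Fin m)))

variable [RiemannianBundle (fun x : M => TangentSpace (𝓡 m) x)]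

variable (m M) in
/-- An orientation of a Riemannian manifold: a choice of an orientation of every tangent space
which is coherent, i.e. for which the Riemannian volume form depends continuously on the point. -/
structure ManifoldOrientation where
  /-- The orientation of the tangent space at `x`. -/
  orient : ∀ x : M, Orientation ℝ (TangentSpace (𝓡 m) x) (Fin m)
  coherent : ∀ c : M, ContinuousOn
    (fun z => (orient ((extChartAt (𝓡 m) c).symm z)).volumeForm (coordFrame c z))
    (extChartAt (𝓡 m) c).target

/-- The Riemannian volume form `ν_M` at the point `x`. -/
def ManifoldOrientation.volForm (o : ManifoldOrientation m M) (x : M) :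
    TangentSpace (𝓡 m) x [⋀^Fin m]→ₗ[ℝ] ℝ :=
  (o.orient x).volumeForm

variable [IsManifold (𝓡 m) ∞ M] [T2Space M] [CompactSpace M]

variable (m M) in
/-- A smooth partition of unity subordinate to the domains of the charts. -/
def chartPartition : SmoothPartitionOfUnity M (𝓡 m) M :=
  (SmoothPartitionOfUnity.exists_isSubordinate_chartAt_source (𝓡 m) M).choose

/-- The integral over the compact oriented manifold `M` of a (complex valued) top degree form:
`∑ c, ∫ ρ_c(z) η(∂₁, …, ∂ₘ) dz` for a partition of unity `ρ_c` subordinate to the charts, where a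
chart counts with the sign `+1` or `-1` according to whether or not it is oriented at `z`. -/
def integralForm (o : ManifoldOrientation m M)
    (η : ∀ x : M, (Fin m → TangentSpace (𝓡 m) x) → ℂ) : ℂ :=
  ∑ᶠ c : M, ∫ z in (extChartAt (𝓡 m) c).target,
    ((chartPartition m M c ((extChartAt (𝓡 m) c).symm z) *
      (SignType.sign (o.volForm ((extChartAt (𝓡 m) c).symm z) (coordFrame c z)) : ℝ) : ℝ) : ℂ) *
      η ((extChartAt (𝓡 m) c).symm z) (coordFrame c z)

end Forms

/-! ## Hermitian vector bundles and their connections -/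

section Bundles

variable {m : ℕ} {M : Type*} [TopologicalSpace M] [ChartedSpace (EuclideanSpace ℝ (Fin m)) M]
  [IsManifold (𝓡 m) ∞ M]
  {F : Type*} [NormedAddCommGroup F] [NormedSpace ℂ F]
  {E : M → Type*} [TopologicalSpace (TotalSpace F E)]
  [∀ x, NormedAddCommGroup (E x)] [∀ x, InnerProductSpace ℂ (E x)]
  [FiberBundle F E] [VectorBundle ℂ F E] [VectorBundle ℝ F E]

variable (m F E) in
/-- The Hermitian inner products on the fibres of a complex vector bundle depend smoothly on the
point: in a trivialization, inner products of constant sections are smooth functions. -/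
class IsSmoothHermitianBundle : Prop where
  contMDiffOn_inner : ∀ (e : Trivialization F (TotalSpace.proj : TotalSpace F E → M))
    [MemTrivializationAtlas e] (a b : F),
    ContMDiffOn (𝓡 m) 𝓘(ℝ, ℂ) ∞ (fun x => inner ℂ (e.symm x a) (e.symm x b)) e.baseSet

variable (m F E) in
/-- A smooth connection on the complex vector bundle `E` over the real manifold `M`: a smooth
covariant derivative which is complex linear. (`D σ x v` is the derivative of the section `σ` at
the point `x` in the direction `v`.) -/
structure ComplexConnection extends CovariantDerivative (𝓡 m) F E where
  smooth : ContMDiffCovariantDerivativeOn F ∞ toFun Set.univ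
  smul_section : ∀ (a : ℂ) {σ : ∀ x, E x} {x : M},
    MDifferentiableAt (𝓡 m) ((𝓡 m).prod 𝓘(ℝ, F)) (fun y => TotalSpace.mk' F y (σ y)) x →
    ∀ v : TangentSpace (𝓡 m) x, toFun (fun y => a • σ y) x v = a • toFun σ x v

namespace ComplexConnection

/-- A connection is Hermitian if `d⟨σ, τ⟩ = ⟨D σ, τ⟩ + ⟨σ, D τ⟩`. -/
def IsHermitian (D : ComplexConnection m F E) : Prop :=
  ∀ (σ τ : ∀ x, E x) (x : M),
    MDifferentiableAt (𝓡 m) ((𝓡 m).prod 𝓘(ℝ, F)) (fun y => TotalSpace.mk' F y (σ y)) x →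
    MDifferentiableAt (𝓡 m) ((𝓡 m).prod 𝓘(ℝ, F)) (fun y => TotalSpace.mk' F y (τ y)) x →
    ∀ v : TangentSpace (𝓡 m) x,
      mvfderiv (𝓡 m) (fun y => inner ℂ (σ y) (τ y)) x v =
        inner ℂ (D.toFun σ x v) (τ x) + inner ℂ (σ x) (D.toFun τ x v)

/-- The curvature expression `D_X D_Y σ - D_Y D_X σ - D_[X, Y] σ` at the point `x`. -/
def curvatureExpr (D : ComplexConnection m F E) (X Y : ∀ x : M, TangentSpace (𝓡 m) x)
    (σ : ∀ x, E x) (x : M) : E x :=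
  D.toFun (fun y => D.toFun σ y (Y y)) x (X x) - D.toFun (fun y => D.toFun σ y (X y)) x (Y x)
    - D.toFun σ x (VectorField.mlieBracket (𝓡 m) X Y x)

lemma extend_add {x : M} (s t : E x) : ∀ᶠ y in 𝓝 x,
    FiberBundle.extend F (s + t) y = FiberBundle.extend F s y + FiberBundle.extend F t y := by
  have hx := FiberBundle.mem_baseSet_trivializationAt' (F := F) (E := E) x
  filter_upwards [(trivializationAt F E x).open_baseSet.mem_nhds hx] with y hy
  have h1 := ((trivializationAt F E x).linear ℂ hx).map_add s t
  have h2 := ((trivializationAt F E x).symmₗ ℂ y).map_add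
  rw [Trivialization.coe_symmₗ _ hy] at h2
  simp only [FiberBundle.extend]
  rw [← h2, h1]

lemma extend_smul {x : M} (a : ℂ) (s : E x) : ∀ᶠ y in 𝓝 x,
    FiberBundle.extend F (a • s) y = a • FiberBundle.extend F s y := by
  have hx := FiberBundle.mem_baseSet_trivializationAt' (F := F) (E := E) x
  filter_upwards [(trivializationAt F E x).open_baseSet.mem_nhds hx] with y hy
  have h1 := ((trivializationAt F E x).linear ℂ hx).map_smul a s
  have h2 := ((trivializationAt F E x).symmₗ ℂ y).map_smul a
  rw [Trivialization.coe_symmₗ _ hy] at h2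
  simp only [FiberBundle.extend]
  rw [← h2, h1]

variable [T2Space M]

/-- If `σ` is smooth near `x` and `Y` is differentiable at `x`, then `D_Y σ` is differentiable. -/
lemma mdifferentiableAt_apply (D : ComplexConnection m F E) {σ : ∀ x, E x} {x : M} {s : Set M}
    (hs : s ∈ 𝓝 x)
    (hσ : ContMDiffOn (𝓡 m) ((𝓡 m).prod 𝓘(ℝ, F)) ∞ (fun y => TotalSpace.mk' F y (σ y)) s)
    {Y : ∀ x : M, TangentSpace (𝓡 m) x} (hY : ContMDiffAt (𝓡 m)
      ((𝓡 m).prod 𝓘(ℝ, EuclideanSpace ℝ (Fin m))) 1 (T% Y) x) :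
    MDifferentiableAt (𝓡 m) ((𝓡 m).prod 𝓘(ℝ, F))
      (fun y => TotalSpace.mk' F y (D.toFun σ y (Y y))) x := by
  obtain ⟨u, hus, huo, hxu⟩ := mem_nhds_iff.1 hs
  obtain ⟨f, -, hf⟩ := (SmoothBumpFunction.nhds_basis_tsupport (I := 𝓡 m) x).mem_iff.1
    (huo.mem_nhds hxu)
  have h1 := ContMDiffOn.smul_section_of_tsupport (n := ∞) (f.contMDiff.contMDiffOn (s := u))
    huo hf (hσ.mono hus)
  have h2 := (D.smooth.contMDiff (σ := (f : M → ℝ) • σ) (by simpa using h1.contMDiffOn))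
  have h3 := ((h2.contMDiffAt Filter.univ_mem).of_le (m := 1) (by norm_cast)
    ).clm_bundle_apply hY
  have h4 := h3.mdifferentiableAt one_ne_zero
  refine h4.congr_of_eventuallyEq ?_
  filter_upwards [f.eventuallyEq_one.eventuallyEq_nhds, huo.mem_nhds hxu] with y hy hyu
  have h5 : MDifferentiableAt (𝓡 m) ((𝓡 m).prod 𝓘(ℝ, F)) (fun y => TotalSpace.mk' F y (σ y)) y :=
    ((hσ.mono hus).contMDiffAt (huo.mem_nhds hyu)).mdifferentiableAt (by simp)
  have h6 := D.isCovariantDerivativeOnUniv.congr_of_eventuallyEq (σ' := (f : M → ℝ) • σ) h5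
    (h1.mdifferentiableAt (by simp)) Filter.univ_mem
    (hy.mono fun z hz => by simp [hz])
  rw [h6]

lemma curvatureExpr_add (D : ComplexConnection m F E) {x : M} {a b c : Set M}
    {X Y : ∀ x : M, TangentSpace (𝓡 m) x} {σ τ ρ : ∀ x, E x}
    (hX : ContMDiffAt (𝓡 m) ((𝓡 m).prod 𝓘(ℝ, EuclideanSpace ℝ (Fin m))) 1 (T% X) x)
    (hY : ContMDiffAt (𝓡 m) ((𝓡 m).prod 𝓘(ℝ, EuclideanSpace ℝ (Fin m))) 1 (T% Y) x)
    (ha : a ∈ 𝓝 x)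
    (hσ : ContMDiffOn (𝓡 m) ((𝓡 m).prod 𝓘(ℝ, F)) ∞ (fun y => TotalSpace.mk' F y (σ y)) a)
    (hb : b ∈ 𝓝 x)
    (hτ : ContMDiffOn (𝓡 m) ((𝓡 m).prod 𝓘(ℝ, F)) ∞ (fun y => TotalSpace.mk' F y (τ y)) b)
    (hc : c ∈ 𝓝 x)
    (hρ : ContMDiffOn (𝓡 m) ((𝓡 m).prod 𝓘(ℝ, F)) ∞ (fun y => TotalSpace.mk' F y (ρ y)) c)
    (h : ∀ᶠ y in 𝓝 x, ρ y = σ y + τ y) :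
    D.curvatureExpr X Y ρ x = D.curvatureExpr X Y σ x + D.curvatureExpr X Y τ x := by
  have key0 : ∀ᶠ y in 𝓝 x, D.toFun ρ y = D.toFun σ y + D.toFun τ y := by
    filter_upwards [eventually_mem_nhds_iff.2 ha, eventually_mem_nhds_iff.2 hb,
      eventually_mem_nhds_iff.2 hc, h.eventually_nhds] with y hya hyb hyc hy
    have h1 := (hσ.contMDiffAt hya).mdifferentiableAt (by simp)
    have h2 := (hτ.contMDiffAt hyb).mdifferentiableAt (by simp)
    have h3 := (hρ.contMDiffAt hyc).mdifferentiableAt (by simp)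
    rw [← D.isCovariantDerivativeOnUniv.add h1 h2]
    exact D.isCovariantDerivativeOnUniv.congr_of_eventuallyEq h3
      (mdifferentiableAt_add_section h1 h2) Filter.univ_mem hy
  have key : ∀ Z : ∀ x : M, TangentSpace (𝓡 m) x,
      ContMDiffAt (𝓡 m) ((𝓡 m).prod 𝓘(ℝ, EuclideanSpace ℝ (Fin m))) 1 (T% Z) x →
      D.toFun (fun y => D.toFun ρ y (Z y)) x =
      D.toFun (fun y => D.toFun σ y (Z y)) x + D.toFun (fun y => D.toFun τ y (Z y)) x := by
    intro Z hZ
    have hS := D.mdifferentiableAt_apply ha hσ hZ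
    have hT := D.mdifferentiableAt_apply hb hτ hZ
    have hR := D.mdifferentiableAt_apply hc hρ hZ
    rw [← D.isCovariantDerivativeOnUniv.add hS hT]
    refine D.isCovariantDerivativeOnUniv.congr_of_eventuallyEq hR
      (mdifferentiableAt_add_section hS hT) Filter.univ_mem ?_
    filter_upwards [key0] with y hy
    rw [hy]
    rfl
  simp only [curvatureExpr, key X hX, key Y hY, key0.self_of_nhds, add_apply]
  abel

lemma curvatureExpr_smul (D : ComplexConnection m F E) {x : M} {a c : Set M}
    {X Y : ∀ x : M, TangentSpace (𝓡 m) x} (z : ℂ) {σ ρ : ∀ x, E x}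
    (hX : ContMDiffAt (𝓡 m) ((𝓡 m).prod 𝓘(ℝ, EuclideanSpace ℝ (Fin m))) 1 (T% X) x)
    (hY : ContMDiffAt (𝓡 m) ((𝓡 m).prod 𝓘(ℝ, EuclideanSpace ℝ (Fin m))) 1 (T% Y) x)
    (ha : a ∈ 𝓝 x)
    (hσ : ContMDiffOn (𝓡 m) ((𝓡 m).prod 𝓘(ℝ, F)) ∞ (fun y => TotalSpace.mk' F y (σ y)) a)
    (hc : c ∈ 𝓝 x)
    (hρ : ContMDiffOn (𝓡 m) ((𝓡 m).prod 𝓘(ℝ, F)) ∞ (fun y => TotalSpace.mk' F y (ρ y)) c)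
    (h : ∀ᶠ y in 𝓝 x, ρ y = z • σ y) :
    D.curvatureExpr X Y ρ x = z • D.curvatureExpr X Y σ x := by
  -- near a point where `f` and `z • g` agree and are differentiable, so do their derivatives
  have aux : ∀ (f g : ∀ x, E x) (y : M),
      MDifferentiableAt (𝓡 m) ((𝓡 m).prod 𝓘(ℝ, F)) (fun y => TotalSpace.mk' F y (f y)) y →
      MDifferentiableAt (𝓡 m) ((𝓡 m).prod 𝓘(ℝ, F)) (fun y => TotalSpace.mk' F y (g y)) y →
      (∀ᶠ w in 𝓝 y, f w = z • g w) →
      ∀ v : TangentSpace (𝓡 m) y, D.toFun f y v = z • D.toFun g y v := by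
    intro f g y hf hg hfg v
    rw [← D.smul_section z hg, D.isCovariantDerivativeOnUniv.congr_of_eventuallyEq hf
      (hf.congr_of_eventuallyEq (hfg.mono fun w hw => by simp only [hw])) Filter.univ_mem hfg]
  have key0 : ∀ᶠ y in 𝓝 x, ∀ v : TangentSpace (𝓡 m) y, D.toFun ρ y v = z • D.toFun σ y v := by
    filter_upwards [eventually_mem_nhds_iff.2 ha, eventually_mem_nhds_iff.2 hc,
      h.eventually_nhds] with y hya hyc hy
    exact aux ρ σ y ((hρ.contMDiffAt hyc).mdifferentiableAt (by simp))
      ((hσ.contMDiffAt hya).mdifferentiableAt (by simp)) hy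
  have key : ∀ Z : ∀ x : M, TangentSpace (𝓡 m) x,
      ContMDiffAt (𝓡 m) ((𝓡 m).prod 𝓘(ℝ, EuclideanSpace ℝ (Fin m))) 1 (T% Z) x →
      ∀ v : TangentSpace (𝓡 m) x, D.toFun (fun y => D.toFun ρ y (Z y)) x v =
      z • D.toFun (fun y => D.toFun σ y (Z y)) x v := fun Z hZ =>
    aux _ _ x (D.mdifferentiableAt_apply hc hρ hZ) (D.mdifferentiableAt_apply ha hσ hZ)
      (key0.mono fun y hy => hy (Z y))
  simp only [curvatureExpr, key X hX, key Y hY, key0.self_of_nhds, smul_sub]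

variable [ContMDiffVectorBundle ∞ F E (𝓡 m)]

/-- The curvature `F_D` of the connection at `x`, a two-form with values in the endomorphisms of
the fibre: `F_D(u, v) s = D_X D_Y σ - D_Y D_X σ - D_[X, Y] σ`, evaluated on extensions of the
vectors `u, v, s` to fields `X, Y, σ` that are smooth near `x`. -/
def curvature (D : ComplexConnection m F E) (x : M) (w : Fin 2 → TangentSpace (𝓡 m) x) :
    E x →ₗ[ℂ] E x where
  toFun s := D.curvatureExpr (FiberBundle.extend (EuclideanSpace ℝ (Fin m)) (w 0))
    (FiberBundle.extend (EuclideanSpace ℝ (Fin m)) (w 1)) (FiberBundle.extend F s) x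
  map_add' s t := by
    obtain ⟨a, ha, hσ⟩ := FiberBundle.exists_contMDiffOn_extend (k := ∞) (𝓡 m) F s
    obtain ⟨b, hb, hτ⟩ := FiberBundle.exists_contMDiffOn_extend (k := ∞) (𝓡 m) F t
    obtain ⟨c, hc, hρ⟩ := FiberBundle.exists_contMDiffOn_extend (k := ∞) (𝓡 m) F (s + t)
    exact D.curvatureExpr_add
      (FiberBundle.contMDiffAt_extend (k := 1) (𝓡 m) (EuclideanSpace ℝ (Fin m)) (w 0))
      (FiberBundle.contMDiffAt_extend (k := 1) (𝓡 m) (EuclideanSpace ℝ (Fin m)) (w 1))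
      ha hσ hb hτ hc hρ (extend_add s t)
  map_smul' z s := by
    obtain ⟨a, ha, hσ⟩ := FiberBundle.exists_contMDiffOn_extend (k := ∞) (𝓡 m) F s
    obtain ⟨c, hc, hρ⟩ := FiberBundle.exists_contMDiffOn_extend (k := ∞) (𝓡 m) F (z • s)
    exact D.curvatureExpr_smul z
      (FiberBundle.contMDiffAt_extend (k := 1) (𝓡 m) (EuclideanSpace ℝ (Fin m)) (w 0))
      (FiberBundle.contMDiffAt_extend (k := 1) (𝓡 m) (EuclideanSpace ℝ (Fin m)) (w 1))
      ha hσ hc hρ (extend_smul z s)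

/-- A connection is flat if its curvature vanishes. -/
def IsFlat (D : ComplexConnection m F E) : Prop :=
  ∀ (x : M) (w : Fin 2 → TangentSpace (𝓡 m) x), D.curvature x w = 0

/-- The complex valued four-form `Tr(F_D ∧ F_D)` at the point `x`. -/
def traceSq (D : ComplexConnection m F E) (x : M) :
    (Fin (2 + 2) → TangentSpace (𝓡 m) x) → ℂ :=
  wedge (fun a b : E x →ₗ[ℂ] E x => LinearMap.trace ℂ (E x) (a ∘ₗ b)) (D.curvature x)
    (D.curvature x)

/-- The degree four component `½ Tr((i F_D / 2π)²)` of the Chern character form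
`Tr(exp(i F_D / 2π))` of the connection. -/
def chernCharacterTwo (D : ComplexConnection m F E) (x : M) :
    (Fin (2 + 2) → TangentSpace (𝓡 m) x) → ℂ := fun v =>
  (1 / 2) * (Complex.I / (2 * Real.pi)) ^ 2 * D.traceSq x v

end ComplexConnection

/-- The squared Hilbert-Schmidt norm `Tr(a* a)` of an endomorphism of a Hermitian vector space;
for a skew-Hermitian `a` it is equal to `-Tr(a²)`. -/
def hsNormSq {V : Type*} [NormedAddCommGroup V] [InnerProductSpace ℂ V] [FiniteDimensional ℂ V]
    (a : V →ₗ[ℂ] V) : ℝ :=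
  ∑ k, ‖a (stdOrthonormalBasis ℂ V k)‖ ^ 2

variable (F) in
lemma finiteDimensional_fiber [FiniteDimensional ℂ F] (x : M) : FiniteDimensional ℂ (E x) :=
  Module.Finite.equiv ((trivializationAt F E x).linearEquivAt ℂ x
    (FiberBundle.mem_baseSet_trivializationAt' x)).symm

namespace ComplexConnection

variable [T2Space M] [ContMDiffVectorBundle ∞ F E (𝓡 m)] [FiniteDimensional ℂ F]
  [RiemannianBundle (fun x : M => TangentSpace (𝓡 m) x)]

/-- The squared pointwise norm `|F_D|² = ∑_{i < j} |F_D(eᵢ, eⱼ)|²` of the curvature, for an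
orthonormal basis `eᵢ` of the tangent space. -/
def curvatureNormSq (D : ComplexConnection m F E) (x : M) : ℝ :=
  haveI : FiniteDimensional ℂ (E x) := finiteDimensional_fiber F x
  ∑ i, ∑ j ∈ Finset.Ioi i,
    hsNormSq (D.curvature x ![stdOrthonormalBasis ℝ (TangentSpace (𝓡 m) x) i,
      stdOrthonormalBasis ℝ (TangentSpace (𝓡 m) x) j])

end ComplexConnection
end Bundles

/-! ## Calibrated connections and the Chern number -/

section Calibrated

variable {n : ℕ} {M : Type*} [TopologicalSpace M]
  [ChartedSpace (EuclideanSpace ℝ (Fin (4 + n))) M]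
  [IsManifold (𝓡 (4 + n)) ∞ M] [T2Space M]
  [RiemannianBundle (fun x : M => TangentSpace (𝓡 (4 + n)) x)]
  {F : Type*} [NormedAddCommGroup F] [NormedSpace ℂ F] [FiniteDimensional ℂ F]
  {E : M → Type*} [TopologicalSpace (TotalSpace F E)]
  [∀ x, NormedAddCommGroup (E x)] [∀ x, InnerProductSpace ℂ (E x)]
  [FiberBundle F E] [VectorBundle ℂ F E] [VectorBundle ℝ F E]
  [ContMDiffVectorBundle ∞ F E (𝓡 (4 + n))]

namespace ComplexConnection

/-- A Hermitian connection `D` is calibrated by the `(dim M - 4)`-form `Φ` if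
`q_Φ(F_D) = |F_D|²`, that is, `Tr(F_D ∧ F_D) ∧ Φ = |F_D|² ν_M`. -/
def IsCalibrated (D : ComplexConnection (4 + n) F E) (o : ManifoldOrientation (4 + n) M)
    (Φ : ∀ x : M, TangentSpace (𝓡 (4 + n)) x [⋀^Fin n]→L[ℝ] ℝ) : Prop :=
  D.IsHermitian ∧ ∀ (x : M) (v : Fin (4 + n) → TangentSpace (𝓡 (4 + n)) x),
    wedge (fun a b : ℂ => a * b) (D.traceSq x) (fun w => ((Φ x w : ℝ) : ℂ)) v =
      ((D.curvatureNormSq x * o.volForm x v : ℝ) : ℂ)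

/-- The number `∫_M ch(E) Φ`, computed by means of the connection `D` on `E`. Only the component
of `ch(E)` of degree four contributes, as `Φ` has degree `dim M - 4`. -/
def chernNumber [CompactSpace M] (D : ComplexConnection (4 + n) F E)
    (o : ManifoldOrientation (4 + n) M)
    (Φ : ∀ x : M, TangentSpace (𝓡 (4 + n)) x [⋀^Fin n]→L[ℝ] ℝ) : ℂ :=
  integralForm o fun x =>
    wedge (fun a b : ℂ => a * b) (D.chernCharacterTwo x) (fun w => ((Φ x w : ℝ) : ℂ))

end ComplexConnection

end Calibrated

/-- A Hermitian vector bundle is flat if it has a flat Hermitian connection. -/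
def IsFlatBundle (m : ℕ) {M : Type*} [TopologicalSpace M]
    [ChartedSpace (EuclideanSpace ℝ (Fin m)) M] [IsManifold (𝓡 m) ∞ M] [T2Space M]
    (F : Type*) [NormedAddCommGroup F] [NormedSpace ℂ F]
    (E : M → Type*) [TopologicalSpace (TotalSpace F E)]
    [∀ x, NormedAddCommGroup (E x)] [∀ x, InnerProductSpace ℂ (E x)]
    [FiberBundle F E] [VectorBundle ℂ F E] [VectorBundle ℝ F E]
    [ContMDiffVectorBundle ∞ F E (𝓡 m)] : Prop :=
  ∃ D : ComplexConnection m F E, D.IsHermitian ∧ D.IsFlat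

end

/-!
Chern–Weil theory through transgression. In a chart and a trivialization, the Chern–Simons form of
two connections is a primitive of the difference of their forms `Tr(F ∧ F)`, and as `Φ` is closed,
its product with `Φ` is a primitive of the difference of the densities `Tr(F ∧ F) ∧ Φ`. By Stokes'
theorem, changing a connection inside a compact subset of such a patch does not change the
integral. Multiplying the difference of two connections by the partial sums of a partition of unity
leads from one to the other in finitely many such changes, so `∫ ch(E) Φ` does not depend on the
connection. For the calibrated connection the integrand is `-|F_D|² / (8π²)` times the volume form,
so the integral is real and nonpositive, and vanishes only if `F_D = 0`; a flat connection gives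
the value `0`.
-/

noncomputable section

section Alternation

open Equiv.Perm (sign)

variable {T ι : Type*} [Fintype ι] [DecidableEq ι]

/-- The alternation `∑ σ, sign σ • G (v ∘ σ)` of a function `G` of a family of vectors, evaluated
at the family `v`. As a functional of `G` it is linear, although `G` need not be multilinear. -/
def alternation (v : ι → T) : ((ι → T) → ℂ) →ₗ[ℂ] ℂ :=
  ∑ σ : Equiv.Perm ι, sign σ • LinearMap.proj (v ∘ σ)

lemma alternation_apply (v : ι → T) (G : (ι → T) → ℂ) :
    alternation v G = ∑ σ : Equiv.Perm ι, sign σ • G (v ∘ σ) := by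
  simp [alternation]

/-- A functional on the functions of a family of vectors is antisymmetric if a permutation of the
arguments changes its value by the sign. This is all that the Chern–Simons identity needs to know
about wedging with a fixed form and evaluating. -/
def IsAntisymmetric (S : ((ι → T) → ℂ) →ₗ[ℂ] ℂ) : Prop :=
  ∀ (p : Equiv.Perm ι) (G : (ι → T) → ℂ), S (fun u => G (u ∘ p)) = sign p • S G

lemma isAntisymmetric_alternation (v : ι → T) : IsAntisymmetric (alternation v) := by
  intro p G
  rw [alternation_apply, alternation_apply, Finset.smul_sum]
  conv_rhs => rw [← Equiv.sum_comp (Equiv.mulRight p)]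
  refine Finset.sum_congr rfl fun σ _ => ?_
  rw [Equiv.coe_mulRight, map_mul, smul_smul, mul_comm (sign σ), ← mul_assoc, Int.units_mul_self,
    one_mul]
  rfl

namespace IsAntisymmetric

variable {S : ((ι → T) → ℂ) →ₗ[ℂ] ℂ}

lemma map_comp_of_sign_eq_one (hS : IsAntisymmetric S) {p : Equiv.Perm ι} (hp : sign p = 1)
    (G : (ι → T) → ℂ) : S (fun u => G (u ∘ p)) = S G := by
  rw [hS, hp, one_smul]

lemma map_comp_of_sign_eq_neg_one (hS : IsAntisymmetric S) {p : Equiv.Perm ι} (hp : sign p = -1)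
    (G : (ι → T) → ℂ) : S (fun u => G (u ∘ p)) = -S G := by
  rw [hS, hp, Units.neg_smul, one_smul]

lemma eq_zero_of_odd_invariant (hS : IsAntisymmetric S) {p : Equiv.Perm ι} (hp : sign p = -1)
    {G : (ι → T) → ℂ} (hG : ∀ u, G (u ∘ p) = G u) : S G = 0 := by
  have h := hS.map_comp_of_sign_eq_neg_one hp G
  simp only [hG] at h
  exact self_eq_neg.1 h

lemma map_sum_sign_smul_comp (hS : IsAntisymmetric S) {κ : Type*} [Fintype κ]
    (p : κ → Equiv.Perm ι) (G : (ι → T) → ℂ) :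
    S (fun u => ∑ i, sign (p i) • G (u ∘ p i)) = Fintype.card κ * S G := by
  have hsum : (fun u => ∑ i, sign (p i) • G (u ∘ p i)) =
      ∑ i, (((sign (p i) : ℤ) : ℂ) • fun u => G (u ∘ p i)) := by
    ext u
    simp [Units.smul_def]
  have hterm (i : κ) : ((sign (p i) : ℤ) : ℂ) • S (fun u => G (u ∘ p i)) = S G := by
    rw [hS, Int.cast_smul_eq_zsmul, ← Units.smul_def, smul_smul, Int.units_mul_self, one_smul]
  simp [hsum, map_sum, map_smul, hterm, -smul_eq_mul]

lemma map_alternation (hS : IsAntisymmetric S) (G : (ι → T) → ℂ) :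
    S (fun u => alternation u G) = (Fintype.card ι).factorial * S G := by
  simp only [alternation_apply, hS.map_sum_sign_smul_comp fun σ => σ, Fintype.card_perm]

lemma eq_zero_of_sum_sign_smul_comp (hS : IsAntisymmetric S) {κ : Type*} [Fintype κ] [Nonempty κ]
    (p : κ → Equiv.Perm ι) {G : (ι → T) → ℂ} (hG : ∀ u, ∑ i, sign (p i) • G (u ∘ p i) = 0) :
    S G = 0 := by
  have h := hS.map_sum_sign_smul_comp p G
  simp only [hG] at h
  exact (mul_eq_zero.1 (h.symm.trans (map_zero S))).resolve_left
    (Nat.cast_ne_zero.2 Fintype.card_ne_zero)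

end IsAntisymmetric

variable {k l : ℕ}

/-- The tensor product `g ⊗ φ`, as a linear map of `g`: the first `k` vectors are handed to `g`
and the last `l` to `φ`. -/
def tensorRight (φ : (Fin l → T) → ℂ) : ((Fin k → T) → ℂ) →ₗ[ℂ] ((Fin (k + l) → T) → ℂ) where
  toFun g u := g (u ∘ Fin.castAdd l) * φ (u ∘ Fin.natAdd k)
  map_add' g g' := by ext u; simp [add_mul]
  map_smul' a g := by ext u; simp [mul_assoc]

lemma tensorRight_apply (φ : (Fin l → T) → ℂ) (g : (Fin k → T) → ℂ) (u : Fin (k + l) → T) :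
    tensorRight φ g u = g (u ∘ Fin.castAdd l) * φ (u ∘ Fin.natAdd k) := rfl

lemma IsAntisymmetric.comp_tensorRight {S : ((Fin (k + l) → T) → ℂ) →ₗ[ℂ] ℂ}
    (hS : IsAntisymmetric S) (φ : (Fin l → T) → ℂ) : IsAntisymmetric (S ∘ₗ tensorRight φ) := by
  intro p g
  set q : Equiv.Perm (Fin (k + l)) := p.viaFintypeEmbedding (Fin.castAddEmb l) with hq
  have hleft (i : Fin k) : q (Fin.castAdd l i) = Fin.castAdd l (p i) :=
    p.viaFintypeEmbedding_apply_image (Fin.castAddEmb l) i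
  have hright (j : Fin l) : q (Fin.natAdd k j) = Fin.natAdd k j := by
    refine p.viaFintypeEmbedding_apply_notMem_range (Fin.castAddEmb l) ?_
    rintro ⟨i, hi⟩
    exact absurd (congrArg Fin.val hi) (by simp; omega)
  have hcomp : tensorRight φ (fun x => g (x ∘ p)) = fun u => tensorRight φ g (u ∘ q) := by
    ext u
    simp only [tensorRight_apply, Function.comp_def, hleft, hright]
  rw [LinearMap.comp_apply, hcomp, hS q, hq, Equiv.Perm.viaFintypeEmbedding_sign]
  rfl

/-- The functions `(u₀, …, uₙ) ↦ (-1)ⁱ L uᵢ (u₀, …, ûᵢ, …, uₙ)` are, up to sign, permutations of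
each other, and their sum is the alternatization of `L`. -/
lemma IsAntisymmetric.map_mul_eq_zero {V : Type*} [NormedAddCommGroup V] [NormedSpace ℝ V] {n : ℕ}
    {S : ((ι → V) → ℂ) →ₗ[ℂ] ℂ} (hS : IsAntisymmetric S) (ε : Fin (n + 1) ↪ ι)
    {L : V →L[ℝ] V [⋀^Fin n]→L[ℝ] ℝ} (hL : ContinuousAlternatingMap.alternatizeUncurryFin L = 0)
    {g : (ι → V) → ℂ} (hg : ∀ u u' : ι → V, (∀ i ∉ Set.range ε, u i = u' i) → g u = g u') :
    S (fun u => g u * ((L (u (ε 0)) fun j => u (ε j.succ) : ℝ) : ℂ)) = 0 := by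
  set p : Fin (n + 1) → Equiv.Perm ι := fun i =>
    Equiv.Perm.viaFintypeEmbedding i.cycleRange.symm ε with hp
  refine hS.eq_zero_of_sum_sign_smul_comp p fun u => ?_
  have hsign (i : Fin (n + 1)) : sign (p i) = (-1) ^ (i : ℕ) := by
    simp [hp, Equiv.Perm.viaFintypeEmbedding_sign, Fin.sign_cycleRange]
  have hgp (i : Fin (n + 1)) : g (u ∘ p i) = g u := hg _ _ fun j hj => by
    rw [Function.comp_apply, hp, Equiv.Perm.viaFintypeEmbedding_apply_notMem_range _ _ hj]
  have hhead (i : Fin (n + 1)) : p i (ε 0) = ε i := by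
    simp [hp, Equiv.Perm.viaFintypeEmbedding_apply_image]
  have htail (i : Fin (n + 1)) (j : Fin n) : p i (ε j.succ) = ε (i.succAbove j) := by
    simp [hp, Equiv.Perm.viaFintypeEmbedding_apply_image]
  have hsum : ∑ i : Fin (n + 1), (-1 : ℝ) ^ (i : ℕ) * L (u (ε i)) (fun j => u (ε (i.succAbove j)))
      = 0 := by
    have h := DFunLike.congr_fun hL (u ∘ ε)
    rw [ContinuousAlternatingMap.alternatizeUncurryFin_apply] at h
    simp only [zsmul_eq_mul] at h
    exact_mod_cast h
  calc ∑ i, sign (p i) • (g (u ∘ p i) *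
        ((L ((u ∘ p i) (ε 0)) fun j => (u ∘ p i) (ε j.succ) : ℝ) : ℂ))
      = g u * ((∑ i : Fin (n + 1), (-1 : ℝ) ^ (i : ℕ) *
          L (u (ε i)) (fun j => u (ε (i.succAbove j))) : ℝ) : ℂ) := by
        simp only [hgp, hsign, hhead, htail, Function.comp_apply, Units.smul_def,
          Complex.ofReal_sum, Finset.mul_sum]
        refine Finset.sum_congr rfl fun i _ => ?_
        push_cast [zsmul_eq_mul]
        ring
    _ = 0 := by rw [hsum, Complex.ofReal_zero, mul_zero]

end Alternation

section Wedge

variable {T A B : Type*} {k l r : ℕ}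

lemma wedge_eq_alternation (μ : A → B → ℂ) (α : (Fin k → T) → A) (β : (Fin l → T) → B)
    (v : Fin (k + l) → T) : wedge μ α β v = ((k.factorial * l.factorial : ℕ) : ℂ)⁻¹ *
      alternation v fun u => μ (α (u ∘ Fin.castAdd l)) (β (u ∘ Fin.natAdd k)) := by
  simp only [wedge, alternation_apply, Units.smul_def, zsmul_eq_mul]
  rfl

lemma wedge_wedge_eq_alternation (μ : A → B → ℂ) (α : (Fin k → T) → A) (β : (Fin l → T) → B)
    (γ : (Fin r → T) → ℂ) (v : Fin (k + l + r) → T) :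
    wedge (· * ·) (wedge μ α β) γ v = ((k.factorial * l.factorial * r.factorial : ℕ) : ℂ)⁻¹ *
      alternation v (tensorRight γ fun x =>
        μ (α (x ∘ Fin.castAdd l)) (β (x ∘ Fin.natAdd k))) := by
  set g : (Fin (k + l) → T) → ℂ := fun x => μ (α (x ∘ Fin.castAdd l)) (β (x ∘ Fin.natAdd k))
  have hS := (isAntisymmetric_alternation v).comp_tensorRight γ
  have hwedge : wedge μ α β =
      ((k.factorial * l.factorial : ℕ) : ℂ)⁻¹ • fun x => alternation x g :=
    funext fun x => wedge_eq_alternation μ α β x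
  have halt := hS.map_alternation g
  rw [LinearMap.comp_apply, LinearMap.comp_apply, Fintype.card_fin] at halt
  rw [wedge_eq_alternation]
  change _ * alternation v (tensorRight γ (wedge μ α β)) = _
  rw [hwedge, map_smul, map_smul, halt, smul_eq_mul]
  have := Nat.factorial_ne_zero (k + l)
  push_cast
  field_simp

lemma wedge_const_mul_left (a : ℂ) (α : (Fin k → T) → ℂ) (β : (Fin l → T) → ℂ)
    (v : Fin (k + l) → T) :
    wedge (· * ·) (fun w => a * α w) β v = a * wedge (· * ·) α β v := by
  simp only [wedge, Finset.mul_sum]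
  exact Finset.sum_congr rfl fun σ _ => by ring

lemma exists_alternatingMap_eq_wedge [AddCommGroup T] [Module ℝ T] [AddCommGroup A] [Module ℝ A]
    [AddCommGroup B] [Module ℝ B] (μ : A →ₗ[ℝ] B →ₗ[ℝ] ℂ)
    (α : MultilinearMap ℝ (fun _ : Fin k => T) A) (β : MultilinearMap ℝ (fun _ : Fin l => T) B) :
    ∃ η : T [⋀^Fin (k + l)]→ₗ[ℝ] ℂ, ⇑η = wedge (fun a b => μ a b) α β := by
  refine ⟨((((k.factorial * l.factorial : ℕ) : ℝ))⁻¹ : ℝ) • MultilinearMap.alternatization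
    (((TensorProduct.lift μ).compMultilinearMap (α.domCoprod β)).domDomCongr finSumFinEquiv),
    funext fun v => ?_⟩
  rw [AlternatingMap.smul_apply, MultilinearMap.alternatization_apply, wedge_eq_alternation,
    alternation_apply, Complex.real_smul]
  push_cast
  rfl

end Wedge

section TraceIdentities

open Equiv (swap)

variable {T 𝔸 : Type*} [Ring 𝔸] {tr : 𝔸 →+ ℂ} {S : ((Fin 4 → T) → ℂ) →ₗ[ℂ] ℂ}

lemma IsAntisymmetric.map_trace_sub_mul_sub (hS : IsAntisymmetric S) (P : T → T → 𝔸) :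
    S (fun x => tr ((P (x 0) (x 1) - P (x 1) (x 0)) * (P (x 2) (x 3) - P (x 3) (x 2)))) =
      4 * S (fun x => tr (P (x 0) (x 1) * P (x 2) (x 3))) := by
  set g : (Fin 4 → T) → ℂ := fun x => tr (P (x 0) (x 1) * P (x 2) (x 3))
  have hexpand : (fun x : Fin 4 → T =>
      tr ((P (x 0) (x 1) - P (x 1) (x 0)) * (P (x 2) (x 3) - P (x 3) (x 2)))) =
      g - (fun x => g (x ∘ swap 0 1)) - (fun x => g (x ∘ swap 2 3)) +
        fun x => g (x ∘ (swap 0 1 * swap 2 3 : Equiv.Perm (Fin 4))) := by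
    ext x
    change _ = tr (P (x 0) (x 1) * P (x 2) (x 3)) - tr (P (x 1) (x 0) * P (x 2) (x 3)) -
      tr (P (x 0) (x 1) * P (x 3) (x 2)) + tr (P (x 1) (x 0) * P (x 3) (x 2))
    simp only [sub_mul, mul_sub, map_sub]
    ring
  rw [hexpand, map_add, map_sub, map_sub, hS.map_comp_of_sign_eq_neg_one (by decide),
    hS.map_comp_of_sign_eq_neg_one (by decide), hS.map_comp_of_sign_eq_one (by decide)]
  ring

lemma IsAntisymmetric.map_trace_of_symm_eq_zero (hS : IsAntisymmetric S) (w : T → 𝔸)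
    {B : T → T → T → 𝔸} (hB : ∀ a b c, B a b c = B b a c) :
    S (fun x => tr (w (x 1) * B (x 0) (x 2) (x 3))) = 0 :=
  hS.eq_zero_of_odd_invariant (p := swap 0 2) (by decide) fun x =>
    congrArg (fun a => tr (w (x 1) * a)) (hB (x 2) (x 0) (x 3))

variable (htr : ∀ a b, tr (a * b) = tr (b * a))
include htr

/-- A cyclic rotation of four factors is an odd permutation. -/
lemma IsAntisymmetric.map_trace_quartic_eq_zero (hS : IsAntisymmetric S) (w : T → 𝔸) :
    S (fun x => tr (w (x 0) * w (x 1) * (w (x 2) * w (x 3)))) = 0 := by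
  refine hS.eq_zero_of_odd_invariant (p := finRotate 4) (by decide) fun x => ?_
  change tr (w (x 1) * w (x 2) * (w (x 3) * w (x 0))) = _
  rw [← mul_assoc, htr, mul_assoc (w (x 0)), mul_assoc (w (x 1))]

variable (A : T → T → 𝔸) (w : T → 𝔸)

lemma IsAntisymmetric.map_trace_middle (hS : IsAntisymmetric S) :
    S (fun x => tr (w (x 1) * A (x 0) (x 2) * w (x 3))) =
      S (fun x => tr (A (x 0) (x 1) * w (x 2) * w (x 3))) := by
  refine Eq.trans ?_ (hS.map_comp_of_sign_eq_one (p := swap 1 2 * swap 2 3) (by decide) _)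
  congr 1 with x
  rw [mul_assoc, htr]
  rfl

lemma IsAntisymmetric.map_trace_last (hS : IsAntisymmetric S) :
    S (fun x => tr (w (x 1) * w (x 2) * A (x 0) (x 3))) =
      S (fun x => tr (A (x 0) (x 1) * w (x 2) * w (x 3))) := by
  refine Eq.trans ?_ (hS.map_comp_of_sign_eq_one (p := swap 2 3 * swap 1 2) (by decide) _)
  congr 1 with x
  rw [htr, ← mul_assoc]
  rfl

lemma IsAntisymmetric.map_trace_swap_pairs (hS : IsAntisymmetric S) :
    S (fun x => tr (w (x 0) * w (x 1) * A (x 2) (x 3))) =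
      S (fun x => tr (A (x 0) (x 1) * w (x 2) * w (x 3))) := by
  refine Eq.trans ?_ (hS.map_comp_of_sign_eq_one (p := swap 0 2 * swap 1 3) (by decide) _)
  congr 1 with x
  rw [htr, ← mul_assoc]
  rfl

/-- `tr ((dw + w ∧ w) ∧ (dw + w ∧ w)) = tr (dw ∧ dw) + 2 tr (dw ∧ w ∧ w)`, with `A` in the place
of `dw`. -/
lemma IsAntisymmetric.map_trace_add_mul_sq (hS : IsAntisymmetric S) :
    S (fun x => tr ((A (x 0) (x 1) + w (x 0) * w (x 1)) * (A (x 2) (x 3) + w (x 2) * w (x 3)))) =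
      S (fun x => tr (A (x 0) (x 1) * A (x 2) (x 3))) +
        2 * S (fun x => tr (A (x 0) (x 1) * w (x 2) * w (x 3))) := by
  have hexpand : (fun x : Fin 4 → T =>
      tr ((A (x 0) (x 1) + w (x 0) * w (x 1)) * (A (x 2) (x 3) + w (x 2) * w (x 3)))) =
      (fun x => tr (A (x 0) (x 1) * A (x 2) (x 3))) +
        (fun x => tr (A (x 0) (x 1) * w (x 2) * w (x 3))) +
        (fun x => tr (w (x 0) * w (x 1) * A (x 2) (x 3))) +
        fun x => tr (w (x 0) * w (x 1) * (w (x 2) * w (x 3))) := by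
    ext x
    simp only [Pi.add_apply, add_mul, mul_add, map_add, mul_assoc]
    ring
  rw [hexpand, map_add, map_add, map_add, hS.map_trace_swap_pairs htr,
    hS.map_trace_quartic_eq_zero htr]
  ring

/-- `d tr (w ∧ dw + ⅔ w ∧ w ∧ w) = tr ((dw + w ∧ w) ∧ (dw + w ∧ w))`, with `A` and `B` in the
place of the first and the second derivative of `w`. -/
lemma IsAntisymmetric.map_trace_curvature_sq (hS : IsAntisymmetric S) {B : T → T → T → 𝔸}
    (hB : ∀ a b c, B a b c = B b a c) :
    S (fun x => tr ((A (x 0) (x 1) - A (x 1) (x 0) + (w (x 0) * w (x 1) - w (x 1) * w (x 0))) *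
        (A (x 2) (x 3) - A (x 3) (x 2) + (w (x 2) * w (x 3) - w (x 3) * w (x 2))))) =
      4 * S (fun x => tr (A (x 0) (x 1) * A (x 2) (x 3) + w (x 1) * B (x 0) (x 2) (x 3)) +
        2 / 3 * tr (A (x 0) (x 1) * w (x 2) * w (x 3) + w (x 1) * A (x 0) (x 2) * w (x 3) +
          w (x 1) * w (x 2) * A (x 0) (x 3))) := by
  have hcurv (a b : T) : A a b - A b a + (w a * w b - w b * w a) =
      (A a b + w a * w b) - (A b a + w b * w a) := by abel
  have hderiv : (fun x : Fin 4 → T =>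
      tr (A (x 0) (x 1) * A (x 2) (x 3) + w (x 1) * B (x 0) (x 2) (x 3)) +
        2 / 3 * tr (A (x 0) (x 1) * w (x 2) * w (x 3) + w (x 1) * A (x 0) (x 2) * w (x 3) +
          w (x 1) * w (x 2) * A (x 0) (x 3))) =
      (fun x => tr (A (x 0) (x 1) * A (x 2) (x 3))) +
        (fun x => tr (w (x 1) * B (x 0) (x 2) (x 3))) +
        (2 / 3 : ℂ) • ((fun x => tr (A (x 0) (x 1) * w (x 2) * w (x 3))) +
          (fun x => tr (w (x 1) * A (x 0) (x 2) * w (x 3))) +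
          fun x => tr (w (x 1) * w (x 2) * A (x 0) (x 3))) := by
    ext x
    simp only [map_add, Pi.add_apply, Pi.smul_apply, smul_eq_mul]
  simp only [hcurv]
  rw [hS.map_trace_sub_mul_sub fun a b => A a b + w a * w b, hS.map_trace_add_mul_sq htr, hderiv,
    map_add, map_add, map_smul, map_add, map_add, hS.map_trace_of_symm_eq_zero w hB,
    hS.map_trace_middle htr, hS.map_trace_last htr, smul_eq_mul]
  ring

end TraceIdentities

section ChernSimons

variable {V : Type*} [NormedAddCommGroup V] [NormedSpace ℝ V]
  {𝔸 : Type*} [NormedRing 𝔸] [NormedAlgebra ℝ 𝔸] {n : ℕ}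

/-- The curvature `dθ + θ ∧ θ` of an algebra valued one-form `θ`. -/
def localCurvature (θ : V → V →L[ℝ] 𝔸) (z u v : V) : 𝔸 :=
  fderiv ℝ θ z u v - fderiv ℝ θ z v u + (θ z u * θ z v - θ z v * θ z u)

/-- The integrand of the Chern–Simons form `tr (θ ∧ dθ + ⅔ θ ∧ θ ∧ θ)`, before alternation. -/
def chernSimons (tr : 𝔸 →L[ℝ] ℂ) (θ : V → V →L[ℝ] 𝔸) (u v w : V) (z : V) : ℂ :=
  tr (θ z u * fderiv ℝ θ z v w) + 2 / 3 * tr (θ z u * θ z v * θ z w)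

/-- The form `tr (F ∧ F) ∧ Φ` for the curvature `F` of `θ`, before alternation. -/
def chernWeil (tr : 𝔸 →L[ℝ] ℂ) (θ : V → V →L[ℝ] 𝔸) (Φ : V → V [⋀^Fin n]→L[ℝ] ℝ) (z : V) :
    (Fin (4 + n) → V) → ℂ :=
  tensorRight (fun y => ((Φ z y : ℝ) : ℂ)) fun x : Fin 4 → V =>
    tr (localCurvature θ z (x 0) (x 1) * localCurvature θ z (x 2) (x 3))

variable {tr : 𝔸 →L[ℝ] ℂ} {θ : V → V →L[ℝ] 𝔸} {Φ : V → V [⋀^Fin n]→L[ℝ] ℝ} {U : Set V}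

lemma contDiffOn_ofReal_apply_form (hΦ : ContDiffOn ℝ ∞ Φ U) (y : Fin n → V) :
    ContDiffOn ℝ ∞ (fun z => ((Φ z y : ℝ) : ℂ)) U :=
  (Complex.ofRealCLM.contDiff.comp
    (ContinuousAlternatingMap.apply ℝ V ℝ y).contDiff).comp_contDiffOn hΦ

lemma contDiffOn_fderiv_apply (hU : IsOpen U) (hθ : ContDiffOn ℝ ∞ θ U) (u v : V) :
    ContDiffOn ℝ ∞ (fun z => fderiv ℝ θ z u v) U :=
  ((hθ.fderiv_of_isOpen hU (by simp)).clm_apply contDiffOn_const).clm_apply contDiffOn_const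

lemma contDiffOn_localCurvature (hU : IsOpen U) (hθ : ContDiffOn ℝ ∞ θ U) (u v : V) :
    ContDiffOn ℝ ∞ (fun z => localCurvature θ z u v) U := by
  have h (w : V) : ContDiffOn ℝ ∞ (fun z => θ z w) U := hθ.clm_apply contDiffOn_const
  exact ((contDiffOn_fderiv_apply hU hθ u v).sub (contDiffOn_fderiv_apply hU hθ v u)).add
    (((h u).mul (h v)).sub ((h v).mul (h u)))

lemma contDiffOn_chernSimons (hU : IsOpen U) (hθ : ContDiffOn ℝ ∞ θ U) (u v w : V) :
    ContDiffOn ℝ ∞ (chernSimons tr θ u v w) U := by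
  have h (w : V) : ContDiffOn ℝ ∞ (fun z => θ z w) U := hθ.clm_apply contDiffOn_const
  exact (tr.contDiff.comp_contDiffOn ((h u).mul (contDiffOn_fderiv_apply hU hθ v w))).add
    (contDiffOn_const.mul (tr.contDiff.comp_contDiffOn (((h u).mul (h v)).mul (h w))))

lemma contDiffOn_chernWeil (hU : IsOpen U) (hθ : ContDiffOn ℝ ∞ θ U) (hΦ : ContDiffOn ℝ ∞ Φ U)
    (u : Fin (4 + n) → V) : ContDiffOn ℝ ∞ (fun z => chernWeil tr θ Φ z u) U :=
  (tr.contDiff.comp_contDiffOn ((contDiffOn_localCurvature hU hθ _ _).mul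
    (contDiffOn_localCurvature hU hθ _ _))).mul (contDiffOn_ofReal_apply_form hΦ _)

lemma fderiv_chernSimons (hU : IsOpen U) (hθ : ContDiffOn ℝ ∞ θ U) {z : V} (hz : z ∈ U)
    (u a b c : V) :
    fderiv ℝ (chernSimons tr θ a b c) z u =
      tr (fderiv ℝ θ z u a * fderiv ℝ θ z b c + θ z a * fderiv ℝ (fderiv ℝ θ) z u b c) +
        2 / 3 * tr (fderiv ℝ θ z u a * θ z b * θ z c + θ z a * fderiv ℝ θ z u b * θ z c +
          θ z a * θ z b * fderiv ℝ θ z u c) := by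
  have hUz := hU.mem_nhds hz
  have dθ : DifferentiableAt ℝ θ z := (hθ.contDiffAt hUz).differentiableAt (by simp)
  have dθ' : DifferentiableAt ℝ (fderiv ℝ θ) z :=
    ((hθ.fderiv_of_isOpen (m := ∞) hU (by simp)).contDiffAt hUz).differentiableAt (by simp)
  have hθv (v : V) : HasFDerivAt (fun y => θ y v) ((fderiv ℝ θ z).flip v) z := by
    simpa using dθ.hasFDerivAt.clm_apply (hasFDerivAt_const v z)
  have hθ'v : HasFDerivAt (fun y => fderiv ℝ θ y b) ((fderiv ℝ (fderiv ℝ θ) z).flip b) z := by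
    simpa using dθ'.hasFDerivAt.clm_apply (hasFDerivAt_const b z)
  have hθ'vw : HasFDerivAt (fun y => fderiv ℝ θ y b c)
      (((fderiv ℝ (fderiv ℝ θ) z).flip b).flip c) z := by
    simpa using hθ'v.clm_apply (hasFDerivAt_const c z)
  have htr {f : V → 𝔸} {f' : V →L[ℝ] 𝔸} (hf : HasFDerivAt f f' z) :
      HasFDerivAt (fun y => tr (f y)) (tr ∘L f') z := tr.hasFDerivAt.comp z hf
  have h := (htr ((hθv a).mul' hθ'vw)).add
    ((htr (((hθv a).mul' (hθv b)).mul' (hθv c))).const_mul (2 / 3 : ℂ))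
  rw [show fderiv ℝ (chernSimons tr θ a b c) z = _ from h.fderiv]
  simp only [add_apply, smul_apply, ContinuousLinearMap.comp_apply,
    ContinuousLinearMap.flip_apply, op_smul_eq_mul, smul_eq_mul, Pi.mul_apply]
  congr 1
  · exact congrArg tr (add_comm _ _)
  · refine congrArg (fun x => 2 / 3 * tr x) ?_
    rw [add_mul]
    abel

/-- The integrand of `tr (θ ∧ dθ + ⅔ θ ∧ θ ∧ θ) ∧ Φ`, before alternation; the argument with index
`0` is left for the direction of differentiation. -/
def chernSimonsWedge (tr : 𝔸 →L[ℝ] ℂ) (θ : V → V →L[ℝ] 𝔸) (Φ : V → V [⋀^Fin n]→L[ℝ] ℝ)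
    (u : Fin (4 + n) → V) (z : V) : ℂ :=
  chernSimons tr θ (u (Fin.castAdd n 1)) (u (Fin.castAdd n 2)) (u (Fin.castAdd n 3)) z *
    ((Φ z (u ∘ Fin.natAdd 4) : ℝ) : ℂ)

lemma contDiffOn_chernSimonsWedge (hU : IsOpen U) (hθ : ContDiffOn ℝ ∞ θ U)
    (hΦ : ContDiffOn ℝ ∞ Φ U) (u : Fin (4 + n) → V) :
    ContDiffOn ℝ ∞ (chernSimonsWedge tr θ Φ u) U :=
  (contDiffOn_chernSimons hU hθ _ _ _).mul (contDiffOn_ofReal_apply_form hΦ _)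

lemma chernSimonsWedge_congr {θ' : V → V →L[ℝ] 𝔸} {z : V} (h : θ =ᶠ[𝓝 z] θ')
    (u : Fin (4 + n) → V) : chernSimonsWedge tr θ Φ u z = chernSimonsWedge tr θ' Φ u z := by
  simp only [chernSimonsWedge, chernSimons, h.fderiv_eq, h.eq_of_nhds]

lemma fderiv_chernSimonsWedge (hU : IsOpen U) (hθ : ContDiffOn ℝ ∞ θ U)
    (hΦ : ContDiffOn ℝ ∞ Φ U) {z : V} (hz : z ∈ U) (u : Fin (4 + n) → V) (v : V) :
    fderiv ℝ (chernSimonsWedge tr θ Φ u) z v =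
      fderiv ℝ (chernSimons tr θ (u (Fin.castAdd n 1)) (u (Fin.castAdd n 2))
        (u (Fin.castAdd n 3))) z v * ((Φ z (u ∘ Fin.natAdd 4) : ℝ) : ℂ) +
      chernSimons tr θ (u (Fin.castAdd n 1)) (u (Fin.castAdd n 2)) (u (Fin.castAdd n 3)) z *
        ((fderiv ℝ Φ z v (u ∘ Fin.natAdd 4) : ℝ) : ℂ) := by
  have hUz := hU.mem_nhds hz
  have hcs := (((contDiffOn_chernSimons (tr := tr) hU hθ (u (Fin.castAdd n 1))
    (u (Fin.castAdd n 2)) (u (Fin.castAdd n 3))).contDiffAt hUz).differentiableAt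
      (by simp)).hasFDerivAt
  have hΦz := ((hΦ.contDiffAt hUz).differentiableAt (by simp)).hasFDerivAt
  have hΦu : HasFDerivAt (fun y => ((Φ y (u ∘ Fin.natAdd 4) : ℝ) : ℂ))
      (Complex.ofRealCLM ∘L
        ContinuousAlternatingMap.apply ℝ V ℝ (u ∘ Fin.natAdd 4) ∘L fderiv ℝ Φ z) z :=
    (Complex.ofRealCLM ∘L
      ContinuousAlternatingMap.apply ℝ V ℝ (u ∘ Fin.natAdd 4)).hasFDerivAt.comp z hΦz
  rw [show fderiv ℝ (chernSimonsWedge tr θ Φ u) z = _ from (hcs.mul hΦu).fderiv]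
  simp [mul_comm, add_comm]

lemma IsAntisymmetric.map_mul_fderiv_form_eq_zero {S : ((Fin (4 + n) → V) → ℂ) →ₗ[ℂ] ℂ}
    (hS : IsAntisymmetric S) {z : V} (hdΦ : extDeriv Φ z = 0) (g : V → V → V → ℂ) :
    S (fun u => g (u (Fin.castAdd n 1)) (u (Fin.castAdd n 2)) (u (Fin.castAdd n 3)) *
      ((fderiv ℝ Φ z (u (Fin.castAdd n 0)) (u ∘ Fin.natAdd 4) : ℝ) : ℂ)) = 0 := by
  set ε : Fin (n + 1) → Fin (4 + n) := Fin.cons (Fin.castAdd n 0) (Fin.natAdd 4)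
  have hε : Function.Injective ε := Fin.cons_injective_iff.2
    ⟨fun ⟨j, hj⟩ => by simp [Fin.ext_iff] at hj, Fin.natAdd_injective n 4⟩
  have hrange (i : Fin 4) (hi : i ≠ 0) : Fin.castAdd n i ∉ Set.range ε := by
    rw [Fin.range_cons]
    rintro (h | ⟨j, hj⟩)
    · exact hi (Fin.castAdd_injective 4 n h)
    · exact absurd (congrArg Fin.val hj) (by simp; omega)
  refine hS.map_mul_eq_zero ⟨ε, hε⟩ (L := fderiv ℝ Φ z) hdΦ (g := fun u =>
    g (u (Fin.castAdd n 1)) (u (Fin.castAdd n 2)) (u (Fin.castAdd n 3))) fun u u' h => ?_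
  simp only [h _ (hrange 1 (by decide)), h _ (hrange 2 (by decide)), h _ (hrange 3 (by decide))]

/-- `d (tr (θ ∧ dθ + ⅔ θ ∧ θ ∧ θ) ∧ Φ) = tr (F ∧ F) ∧ Φ` for closed `Φ`. -/
lemma alternation_chernWeil (htr : ∀ a b, tr (a * b) = tr (b * a)) (hU : IsOpen U)
    (hθ : ContDiffOn ℝ ∞ θ U) (hΦ : ContDiffOn ℝ ∞ Φ U) {z : V} (hz : z ∈ U)
    (hdΦ : extDeriv Φ z = 0) (b : Fin (4 + n) → V) :
    alternation b (chernWeil tr θ Φ z) =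
      4 * alternation b
        (fun u => fderiv ℝ (chernSimonsWedge tr θ Φ u) z (u (Fin.castAdd n 0))) := by
  set S := alternation b
  have hS : IsAntisymmetric S := isAntisymmetric_alternation b
  have hsymm (u v w : V) : fderiv ℝ (fderiv ℝ θ) z u v w = fderiv ℝ (fderiv ℝ θ) z v u w :=
    congrArg (fun l : V →L[ℝ] 𝔸 => l w) <|
      ((hθ.contDiffAt (hU.mem_nhds hz)).isSymmSndFDerivAt
        (by rw [minSmoothness_of_isRCLikeNormedField]; exact ENat.LEInfty.out)).eq u v
  have hcurv := (hS.comp_tensorRight (fun y => ((Φ z y : ℝ) : ℂ))).map_trace_curvature_sq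
    (tr := tr.toLinearMap.toAddMonoidHom) htr (fun u v => fderiv ℝ θ z u v) (θ z) hsymm
  have hsplit : (fun u : Fin (4 + n) → V =>
      fderiv ℝ (chernSimonsWedge tr θ Φ u) z (u (Fin.castAdd n 0))) =
      (tensorRight (fun y => ((Φ z y : ℝ) : ℂ)) fun x : Fin 4 → V =>
        fderiv ℝ (chernSimons tr θ (x 1) (x 2) (x 3)) z (x 0)) +
      fun u => chernSimons tr θ (u (Fin.castAdd n 1)) (u (Fin.castAdd n 2))
        (u (Fin.castAdd n 3)) z *
          ((fderiv ℝ Φ z (u (Fin.castAdd n 0)) (u ∘ Fin.natAdd 4) : ℝ) : ℂ) :=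
    funext fun u => fderiv_chernSimonsWedge hU hθ hΦ hz u _
  rw [hsplit, map_add, hS.map_mul_fderiv_form_eq_zero hdΦ (chernSimons tr θ · · · z), add_zero]
  simp only [fderiv_chernSimons hU hθ hz]
  exact hcurv

end ChernSimons

section Stokes

open MeasureTheory

section Indicator

variable {X : Type*} [TopologicalSpace X] {U K : Set X} {f g : X → ℂ} {z : X}

lemma indicator_mul_eventuallyEq (hU : IsOpen U) (hf : ∀ z ∈ U, z ∉ K → f z = 0)
    (hg : ∀ z ∈ U, ∀ᶠ y in 𝓝 z, g y = g z) (hz : z ∈ U) :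
    K.indicator (fun y => g y * f y) =ᶠ[𝓝 z] fun y => g z * f y := by
  filter_upwards [hg z hz, hU.mem_nhds hz] with y hy hyU
  by_cases hyK : y ∈ K
  · rw [Set.indicator_of_mem hyK, hy]
  · rw [Set.indicator_of_notMem hyK, hf y hyU hyK, mul_zero]

lemma indicator_eventuallyEq_zero (hK : IsClosed K) (hz : z ∉ K) : K.indicator f =ᶠ[𝓝 z] 0 := by
  filter_upwards [hK.isOpen_compl.mem_nhds hz] with y hy using Set.indicator_of_notMem hy f

end Indicator

section ContDiff

variable {V : Type*} [NormedAddCommGroup V] [NormedSpace ℝ V] {U K : Set V} {f g : V → ℂ}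

lemma contDiff_indicator_mul (hU : IsOpen U) (hK : IsClosed K) (hKU : K ⊆ U) {m : WithTop ℕ∞}
    (hfU : ContDiffOn ℝ m f U) (hf : ∀ z ∈ U, z ∉ K → f z = 0)
    (hg : ∀ z ∈ U, ∀ᶠ y in 𝓝 z, g y = g z) :
    ContDiff ℝ m (K.indicator fun y => g y * f y) := by
  refine contDiff_iff_contDiffAt.2 fun z => ?_
  by_cases hz : z ∈ U
  · exact (contDiffAt_const.mul (hfU.contDiffAt (hU.mem_nhds hz))).congr_of_eventuallyEq
      (indicator_mul_eventuallyEq hU hf hg hz)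
  · exact contDiffAt_const.congr_of_eventuallyEq
      (indicator_eventuallyEq_zero hK fun h => hz (hKU h))

lemma indicator_mul_fderiv (hU : IsOpen U) (hK : IsClosed K) (hKU : K ⊆ U)
    (hfU : DifferentiableOn ℝ f U) (hf : ∀ z ∈ U, z ∉ K → f z = 0)
    (hg : ∀ z ∈ U, ∀ᶠ y in 𝓝 z, g y = g z) (v : V) :
    U.indicator (fun z => g z * fderiv ℝ f z v) =
      fun z => fderiv ℝ (K.indicator fun y => g y * f y) z v := by
  ext z
  by_cases hz : z ∈ U
  · rw [Set.indicator_of_mem hz, (indicator_mul_eventuallyEq hU hf hg hz).fderiv_eq,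
      fderiv_const_mul (hfU.differentiableAt (hU.mem_nhds hz))]
    rfl
  · rw [Set.indicator_of_notMem hz,
      (indicator_eventuallyEq_zero hK fun h => hz (hKU h)).fderiv_eq, fderiv_zero]
    rfl

variable [MeasurableSpace V] [BorelSpace V] (μ : Measure V)

lemma integrableOn_mul_fderiv [IsFiniteMeasureOnCompacts μ] (hU : IsOpen U) (hK : IsCompact K)
    (hKU : K ⊆ U) (hfU : ContDiffOn ℝ 1 f U) (hf : ∀ z ∈ U, z ∉ K → f z = 0)
    (hg : ∀ z ∈ U, ∀ᶠ y in 𝓝 z, g y = g z) (v : V) :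
    IntegrableOn (fun z => g z * fderiv ℝ f z v) U μ := by
  rw [← integrable_indicator_iff hU.measurableSet, indicator_mul_fderiv hU hK.isClosed hKU
    (hfU.differentiableOn one_ne_zero) hf hg]
  have hC := contDiff_indicator_mul hU hK.isClosed hKU hfU hf hg
  exact ((hC.continuous_fderiv one_ne_zero).clm_apply
    continuous_const).integrable_of_hasCompactSupport
      ((HasCompactSupport.intro hK fun _ hz => Set.indicator_of_notMem hz _).fderiv_apply ℝ v)

variable [FiniteDimensional ℝ V] [μ.IsAddHaarMeasure]

lemma integral_fderiv_apply_eq_zero {f : V → ℂ} (hf : ContDiff ℝ 1 f) (hcs : HasCompactSupport f)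
    (v : V) : ∫ z, fderiv ℝ f z v ∂μ = 0 := by
  have hint : Integrable (fun z => fderiv ℝ f z v) μ :=
    ((hf.continuous_fderiv one_ne_zero).clm_apply continuous_const).integrable_of_hasCompactSupport
      (hcs.fderiv_apply ℝ v)
  simpa using integral_mul_fderiv_eq_neg_fderiv_mul_of_integrable (μ := μ)
    (f := fun _ : V => (1 : ℂ)) (g := f) (v := v) (by simp) (by simpa using hint)
    (by simpa using hf.continuous.integrable_of_hasCompactSupport hcs)
    (fun _ _ => differentiableAt_const _)
    fun _ _ => (hf.differentiable one_ne_zero).differentiableAt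

lemma setIntegral_mul_fderiv_eq_zero (hU : IsOpen U) (hK : IsCompact K) (hKU : K ⊆ U)
    (hfU : ContDiffOn ℝ 1 f U) (hf : ∀ z ∈ U, z ∉ K → f z = 0)
    (hg : ∀ z ∈ U, ∀ᶠ y in 𝓝 z, g y = g z) (v : V) :
    ∫ z in U, g z * fderiv ℝ f z v ∂μ = 0 := by
  rw [← integral_indicator hU.measurableSet, indicator_mul_fderiv hU hK.isClosed hKU
    (hfU.differentiableOn one_ne_zero) hf hg]
  exact integral_fderiv_apply_eq_zero μ (contDiff_indicator_mul hU hK.isClosed hKU hfU hf hg)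
    (HasCompactSupport.intro hK fun _ hz => Set.indicator_of_notMem hz _) v

variable {𝔸 : Type*} [NormedRing 𝔸] [NormedAlgebra ℝ 𝔸] {n : ℕ}
  {tr : 𝔸 →L[ℝ] ℂ} {θ θ' : V → V →L[ℝ] 𝔸} {Φ : V → V [⋀^Fin n]→L[ℝ] ℝ}

lemma setIntegral_alternation_chernWeil_sub_eq_zero (htr : ∀ a b, tr (a * b) = tr (b * a))
    (hU : IsOpen U) (hK : IsCompact K) (hKU : K ⊆ U) (hθ : ContDiffOn ℝ ∞ θ U)
    (hθ' : ContDiffOn ℝ ∞ θ' U) (hθθ' : ∀ z ∈ U, z ∉ K → θ z = θ' z)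
    (hΦ : ContDiffOn ℝ ∞ Φ U) (hdΦ : ∀ z ∈ U, extDeriv Φ z = 0)
    (hg : ∀ z ∈ U, ∀ᶠ y in 𝓝 z, g y = g z) (b : Fin (4 + n) → V) :
    ∫ z in U, g z * (alternation b (chernWeil tr θ Φ z) - alternation b (chernWeil tr θ' Φ z)) ∂μ
      = 0 := by
  set G : (Fin (4 + n) → V) → V → ℂ := fun u z =>
    chernSimonsWedge tr θ Φ u z - chernSimonsWedge tr θ' Φ u z with hG
  have hc := contDiffOn_chernSimonsWedge (tr := tr) hU hθ hΦ
  have hc' := contDiffOn_chernSimonsWedge (tr := tr) hU hθ' hΦ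
  have hGU u : ContDiffOn ℝ 1 (G u) U := ((hc u).sub (hc' u)).of_le (by norm_cast)
  have hGK u : ∀ z ∈ U, z ∉ K → G u z = 0 := fun z hz hzK => by
    refine sub_eq_zero.2 (chernSimonsWedge_congr ?_ u)
    filter_upwards [hU.mem_nhds hz, hK.isClosed.isOpen_compl.mem_nhds hzK] with y using hθθ' y
  have hint : ∀ z ∈ U, g z * (alternation b (chernWeil tr θ Φ z) -
      alternation b (chernWeil tr θ' Φ z)) = ∑ σ : Equiv.Perm (Fin (4 + n)),
        (4 * ((Equiv.Perm.sign σ : ℤ) : ℂ)) *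
          (g z * fderiv ℝ (G (b ∘ σ)) z (b (σ (Fin.castAdd n 0)))) := fun z hz => by
    have hUz := hU.mem_nhds hz
    have hd u v : fderiv ℝ (G u) z v = fderiv ℝ (chernSimonsWedge tr θ Φ u) z v -
        fderiv ℝ (chernSimonsWedge tr θ' Φ u) z v := by
      rw [hG, fderiv_fun_sub (((hc u).contDiffAt hUz).differentiableAt (by simp))
        (((hc' u).contDiffAt hUz).differentiableAt (by simp))]
      rfl
    rw [alternation_chernWeil htr hU hθ hΦ hz (hdΦ z hz),
      alternation_chernWeil htr hU hθ' hΦ hz (hdΦ z hz), ← mul_sub, ← map_sub, alternation_apply]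
    simp only [hd, Finset.mul_sum, Pi.sub_apply, Units.smul_def, zsmul_eq_mul]
    exact Finset.sum_congr rfl fun σ _ => by simp only [Function.comp_apply]; ring
  rw [setIntegral_congr_fun hU.measurableSet hint, integral_finsetSum _ fun σ _ =>
    (integrableOn_mul_fderiv μ hU hK hKU (hGU _) (hGK _) hg _).const_mul _]
  refine Finset.sum_eq_zero fun σ _ => ?_
  rw [integral_const_mul, setIntegral_mul_fderiv_eq_zero μ hU hK hKU (hGU _) (hGK _) hg, mul_zero]

end ContDiff

end Stokes

section TopDegree

variable {T N : Type*} [AddCommGroup T] [Module ℝ T] [AddCommGroup N] [Module ℝ N] {m : ℕ}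
  (e : Module.Basis (Fin m) ℝ T)
include e

lemma alternatingMap_apply_eq_det_smul (η : T [⋀^Fin m]→ₗ[ℝ] N) (v : Fin m → T) :
    η v = e.det v • η e := by
  have h : η = (LinearMap.toSpanSingleton ℝ N (η e)).compAlternatingMap e.det := by
    refine e.ext_alternating fun i hi => ?_
    obtain ⟨σ, rfl⟩ : ∃ σ : Equiv.Perm (Fin m), ⇑σ = i :=
      ⟨Equiv.ofBijective i (Finite.injective_iff_bijective.1 hi), rfl⟩
    simp [← Function.comp_def, AlternatingMap.map_perm, e.det_self]
  exact DFunLike.congr_fun h v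

lemma exists_alternatingMap_eq_mul {ν : T [⋀^Fin m]→ₗ[ℝ] ℝ} (hν : ν e ≠ 0)
    (η : T [⋀^Fin m]→ₗ[ℝ] ℂ) : ∃ a : ℂ, ∀ v, η v = a * ((ν v : ℝ) : ℂ) := by
  refine ⟨η e / ((ν e : ℝ) : ℂ), fun v => ?_⟩
  have hν' : ((ν e : ℝ) : ℂ) ≠ 0 := by exact_mod_cast hν
  rw [alternatingMap_apply_eq_det_smul e η, alternatingMap_apply_eq_det_smul e ν v, smul_eq_mul,
    Complex.real_smul, Complex.ofReal_mul]
  field_simp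

lemma alternatingMap_comp_eq_det_smul (η : T [⋀^Fin m]→ₗ[ℝ] N) (f : T →ₗ[ℝ] T) (v : Fin m → T) :
    η (f ∘ v) = LinearMap.det f • η v := by
  rw [alternatingMap_apply_eq_det_smul e η, alternatingMap_apply_eq_det_smul e η v, e.det_comp,
    mul_smul]

end TopDegree

lemma volumeForm_basis_ne_zero {m : ℕ} {T : Type*} [NormedAddCommGroup T] [InnerProductSpace ℝ T]
    [FiniteDimensional ℝ T] [hm : Fact (Module.finrank ℝ T = m)] (o : Orientation ℝ T (Fin m))
    (e : Module.Basis (Fin m) ℝ T) : o.volumeForm e ≠ 0 := by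
  rw [AlternatingMap.map_basis_ne_zero_iff e]
  intro h
  have habs := o.abs_volumeForm_apply_of_orthonormal
    ((stdOrthonormalBasis ℝ T).reindex (finCongr hm.out))
  simp [h] at habs

section ChartFrames

variable {m : ℕ} {M : Type*} [TopologicalSpace M] [ChartedSpace (EuclideanSpace ℝ (Fin m)) M]

/-- The transition map from the chart around `c` to the chart around `c'`. -/
abbrev chartTransition (c c' : M) :
    PartialEquiv (EuclideanSpace ℝ (Fin m)) (EuclideanSpace ℝ (Fin m)) :=
  (extChartAt (𝓡 m) c).symm.trans (extChartAt (𝓡 m) c')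

variable {c c' : M} {z : EuclideanSpace ℝ (Fin m)}

lemma extChartAt_symm_chartTransition (hz : z ∈ (chartTransition c c').source) :
    (extChartAt (𝓡 m) c').symm (chartTransition c c' z) = (extChartAt (𝓡 m) c).symm z :=
  (extChartAt (𝓡 m) c').left_inv hz.2

variable [IsManifold (𝓡 m) ∞ M]

lemma contMDiffAt_extChartAt_symm_target (hz : z ∈ (extChartAt (𝓡 m) c).target) :
    ContMDiffAt 𝓘(ℝ, EuclideanSpace ℝ (Fin m)) (𝓡 m) ∞ (extChartAt (𝓡 m) c).symm z :=
  (contMDiffOn_extChartAt_symm c).contMDiffAt ((isOpen_extChartAt_target c).mem_nhds hz)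

lemma isInvertible_mfderiv_extChartAt_symm (hz : z ∈ (extChartAt (𝓡 m) c).target) :
    (mfderiv 𝓘(ℝ, EuclideanSpace ℝ (Fin m)) (𝓡 m) (extChartAt (𝓡 m) c).symm z).IsInvertible := by
  have : IsManifold (𝓡 m) 1 M := IsManifold.of_le (n := ∞) (by norm_cast)
  simpa only [modelWithCornersSelf_coe, Set.range_id, mfderivWithin_univ] using
    isInvertible_mfderivWithin_extChartAt_symm (I := 𝓡 m) hz

lemma exists_basis_eq_coordFrame (hz : z ∈ (extChartAt (𝓡 m) c).target) :
    ∃ b : Module.Basis (Fin m) ℝ (TangentSpace (𝓡 m) ((extChartAt (𝓡 m) c).symm z)),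
      ⇑b = coordFrame c z := by
  obtain ⟨L, hL⟩ := isInvertible_mfderiv_extChartAt_symm hz
  refine ⟨(EuclideanSpace.basisFun (Fin m) ℝ).toBasis.map L.toLinearEquiv, funext fun i => ?_⟩
  have hi : (EuclideanSpace.basisFun (Fin m) ℝ).toBasis i = EuclideanSpace.single i 1 := by simp
  rw [coordFrame, ← hL]
  exact congrArg L hi

lemma isOpen_chartTransition_source (c c' : M) :
    IsOpen (chartTransition (m := m) c c').source :=
  (contMDiffOn_extChartAt_symm (n := ∞) c).continuousOn.isOpen_inter_preimage
    (isOpen_extChartAt_target c) (isOpen_extChartAt_source c')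

lemma contDiffAt_chartTransition (hz : z ∈ (chartTransition c c').source) :
    ContDiffAt ℝ ∞ (chartTransition c c') z := by
  rw [← contMDiffAt_iff_contDiffAt]
  have hz' : (extChartAt (𝓡 m) c).symm z ∈ (extChartAt (𝓡 m) c').source := hz.2
  exact (contMDiffAt_extChartAt' (by simpa only [extChartAt_source] using hz')).comp z
    (contMDiffAt_extChartAt_symm_target hz.1)

lemma hasFDerivAt_chartTransition (hz : z ∈ (chartTransition c c').source) :
    HasFDerivAt (chartTransition c c') (fderiv ℝ (chartTransition c c') z) z :=
  ((contDiffAt_chartTransition hz).differentiableAt (by simp)).hasFDerivAt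

lemma mfderiv_extChartAt_symm_eq_comp (hz : z ∈ (chartTransition c c').source)
    (v : EuclideanSpace ℝ (Fin m)) :
    (mfderiv 𝓘(ℝ, EuclideanSpace ℝ (Fin m)) (𝓡 m) (extChartAt (𝓡 m) c).symm z v :
      EuclideanSpace ℝ (Fin m)) =
    mfderiv 𝓘(ℝ, EuclideanSpace ℝ (Fin m)) (𝓡 m) (extChartAt (𝓡 m) c').symm
      (chartTransition c c' z) (fderiv ℝ (chartTransition c c') z v) := by
  have heq : (extChartAt (𝓡 m) c).symm =ᶠ[𝓝 z]
      (extChartAt (𝓡 m) c').symm ∘ chartTransition c c' := by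
    filter_upwards [(isOpen_chartTransition_source c c').mem_nhds hz] with y hy
    exact (extChartAt_symm_chartTransition hy).symm
  have hsymm := ((contMDiffAt_extChartAt_symm_target
    ((chartTransition c c').map_source hz).1).mdifferentiableAt (by simp)).hasMFDerivAt
  rw [((hsymm.comp z (hasFDerivAt_chartTransition hz).hasMFDerivAt).congr_of_eventuallyEq
    heq).mfderiv]
  rfl

end ChartFrames

section Density

variable {m : ℕ} {M : Type*} [TopologicalSpace M] [ChartedSpace (EuclideanSpace ℝ (Fin m)) M]
  [RiemannianBundle (fun x : M => TangentSpace (𝓡 m) x)]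
  (o : ManifoldOrientation m M) {c c' : M} {z : EuclideanSpace ℝ (Fin m)}

namespace ManifoldOrientation

/-- The signed Riemannian density `ν_M (∂₁, …, ∂ₘ)` in the chart around `c`. -/
def chartDensity (c : M) (z : EuclideanSpace ℝ (Fin m)) : ℝ :=
  o.volForm ((extChartAt (𝓡 m) c).symm z) (coordFrame c z)

lemma continuousOn_chartDensity (c : M) :
    ContinuousOn (o.chartDensity c) (extChartAt (𝓡 m) c).target :=
  o.coherent c

lemma volForm_congr {x y : M} (h : x = y) (v : Fin m → EuclideanSpace ℝ (Fin m)) :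
    o.volForm x v = o.volForm y v := by
  subst h
  rfl

variable [IsManifold (𝓡 m) ∞ M]

lemma chartDensity_ne_zero (hz : z ∈ (extChartAt (𝓡 m) c).target) : o.chartDensity c z ≠ 0 := by
  obtain ⟨b, hb⟩ := exists_basis_eq_coordFrame hz
  rw [chartDensity, ← hb]
  exact volumeForm_basis_ne_zero (o.orient _) b

lemma chartDensity_eq_det_mul (hz : z ∈ (chartTransition c c').source) :
    o.chartDensity c z = (fderiv ℝ (chartTransition c c') z).det *
      o.chartDensity c' (chartTransition c c' z) := by
  set z' := chartTransition c c' z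
  set L := mfderiv 𝓘(ℝ, EuclideanSpace ℝ (Fin m)) (𝓡 m) (extChartAt (𝓡 m) c').symm z'
  have hframe : (coordFrame c z : Fin m → EuclideanSpace ℝ (Fin m)) = fun i =>
      L (fderiv ℝ (chartTransition c c') z (EuclideanSpace.single i (1 : ℝ))) :=
    funext fun i => mfderiv_extChartAt_symm_eq_comp hz _
  calc o.chartDensity c z
      = o.volForm ((extChartAt (𝓡 m) c').symm z') fun i =>
          L (fderiv ℝ (chartTransition c c') z (EuclideanSpace.single i (1 : ℝ))) := by
        rw [← hframe]
        exact o.volForm_congr (extChartAt_symm_chartTransition hz).symm _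
    _ = _ := alternatingMap_comp_eq_det_smul (EuclideanSpace.basisFun (Fin m) ℝ).toBasis
        ((o.volForm ((extChartAt (𝓡 m) c').symm z')).compLinearMap L.toLinearMap)
        (fderiv ℝ (chartTransition c c') z).toLinearMap fun i => EuclideanSpace.single i (1 : ℝ)

end ManifoldOrientation

end Density

section ChartIntegral

open MeasureTheory

variable {m : ℕ} {M : Type*} [TopologicalSpace M] [ChartedSpace (EuclideanSpace ℝ (Fin m)) M]
  [RiemannianBundle (fun x : M => TangentSpace (𝓡 m) x)]
  {E : Type*} [NormedAddCommGroup E] [NormedSpace ℝ E]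
  (o : ManifoldOrientation m M)

namespace ManifoldOrientation

/-- The integral of a function over the domain of the chart around `c` against the Riemannian
density. -/
def chartIntegral (c : M) (f : M → E) : E :=
  ∫ z in (extChartAt (𝓡 m) c).target, |o.chartDensity c z| • f ((extChartAt (𝓡 m) c).symm z)

lemma chartIntegral_eq_setIntegral_transition_source {c c' : M} {f : M → E}
    (hf : Function.support f ⊆ (extChartAt (𝓡 m) c').source) :
    o.chartIntegral c f = ∫ z in (chartTransition c c').source,
      |o.chartDensity c z| • f ((extChartAt (𝓡 m) c).symm z) := by
  refine setIntegral_eq_of_subset_of_forall_sdiff_eq_zero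
    (isOpen_extChartAt_target c).measurableSet Set.inter_subset_left fun z hz => ?_
  have hfz : f ((extChartAt (𝓡 m) c).symm z) = 0 := of_not_not fun h => hz.2 ⟨hz.1, hf h⟩
  rw [hfz, smul_zero]

lemma integrableOn_chartDensity_smul {c : M} {f : M → E}
    (hfc : ContinuousOn f (extChartAt (𝓡 m) c).source) {K : Set M} (hK : IsCompact K)
    (hKc : K ⊆ (extChartAt (𝓡 m) c).source) (hfK : Function.support f ⊆ K) :
    IntegrableOn (fun z => |o.chartDensity c z| • f ((extChartAt (𝓡 m) c).symm z))
      (extChartAt (𝓡 m) c).target := by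
  have hK' : IsCompact (extChartAt (𝓡 m) c '' K) :=
    hK.image_of_continuousOn ((continuousOn_extChartAt c).mono hKc)
  have hsub : extChartAt (𝓡 m) c '' K ⊆ (extChartAt (𝓡 m) c).target :=
    Set.image_subset_iff.2 fun x hx => (extChartAt (𝓡 m) c).map_source (hKc hx)
  have hcont : ContinuousOn (fun z => |o.chartDensity c z| • f ((extChartAt (𝓡 m) c).symm z))
      (extChartAt (𝓡 m) c).target :=
    (o.continuousOn_chartDensity c).abs.smul
      (hfc.comp (continuousOn_extChartAt_symm c) fun z => (extChartAt (𝓡 m) c).map_target)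
  refine ((hcont.mono hsub).integrableOn_compact hK').of_forall_sdiff_eq_zero
    (isOpen_extChartAt_target c).measurableSet fun z hz => ?_
  rw [Function.notMem_support.1 fun h => hz.2 ⟨_, hfK h, (extChartAt (𝓡 m) c).right_inv hz.1⟩,
    smul_zero]

lemma chartIntegral_sub {c : M} {f g : M → E}
    (hf : IntegrableOn (fun z => |o.chartDensity c z| • f ((extChartAt (𝓡 m) c).symm z))
      (extChartAt (𝓡 m) c).target)
    (hg : IntegrableOn (fun z => |o.chartDensity c z| • g ((extChartAt (𝓡 m) c).symm z))
      (extChartAt (𝓡 m) c).target) :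
    o.chartIntegral c (f - g) = o.chartIntegral c f - o.chartIntegral c g := by
  simp only [chartIntegral, Pi.sub_apply, smul_sub]
  exact integral_sub hf hg

lemma chartIntegral_ofReal (c : M) (f : M → ℝ) :
    o.chartIntegral c (fun x => (f x : ℂ)) = (o.chartIntegral c f : ℝ) := by
  simp only [chartIntegral, ← integral_complex_ofReal, Complex.real_smul, smul_eq_mul,
    Complex.ofReal_mul]

lemma chartIntegral_nonneg (c : M) {f : M → ℝ} (hf : 0 ≤ f) : 0 ≤ o.chartIntegral c f :=
  integral_nonneg fun _ => mul_nonneg (abs_nonneg _) (hf _)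

variable [IsManifold (𝓡 m) ∞ M]

lemma chartIntegral_eq_of_support_subset {c c' : M} {f : M → E}
    (hf : Function.support f ⊆ (extChartAt (𝓡 m) c).source)
    (hf' : Function.support f ⊆ (extChartAt (𝓡 m) c').source) :
    o.chartIntegral c f = o.chartIntegral c' f := by
  rw [o.chartIntegral_eq_setIntegral_transition_source hf',
    o.chartIntegral_eq_setIntegral_transition_source hf]
  have himage : chartTransition (m := m) c c' '' (chartTransition c c').source =
      (chartTransition c' c).source :=
    (chartTransition c c').image_source_eq_target
  have hmeas := (isOpen_chartTransition_source (m := m) c c').measurableSet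
  rw [← himage, integral_image_eq_integral_abs_det_fderiv_smul volume hmeas
    (fun z hz => (hasFDerivAt_chartTransition hz).hasFDerivWithinAt) (chartTransition c c').injOn]
  refine setIntegral_congr_fun hmeas fun z hz => ?_
  beta_reduce
  rw [extChartAt_symm_chartTransition hz, o.chartDensity_eq_det_mul hz, abs_mul, mul_smul]

lemma eq_zero_of_chartIntegral_eq_zero {c : M} {f : M → ℝ} (hf : 0 ≤ f)
    (hfc : ContinuousOn f (extChartAt (𝓡 m) c).source)
    (hint : IntegrableOn (fun z => |o.chartDensity c z| • f ((extChartAt (𝓡 m) c).symm z))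
      (extChartAt (𝓡 m) c).target)
    (h : o.chartIntegral c f = 0) {x : M} (hx : x ∈ (extChartAt (𝓡 m) c).source) : f x = 0 := by
  have hae := (setIntegral_eq_zero_iff_of_nonneg_ae
    (Filter.Eventually.of_forall fun z => mul_nonneg (abs_nonneg _) (hf _)) hint).1 h
  have hcont : ContinuousOn (fun z => |o.chartDensity c z| • f ((extChartAt (𝓡 m) c).symm z))
      (extChartAt (𝓡 m) c).target :=
    (o.continuousOn_chartDensity c).abs.smul
      (hfc.comp (continuousOn_extChartAt_symm c) fun z => (extChartAt (𝓡 m) c).map_target)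
  have hxt := (extChartAt (𝓡 m) c).map_source hx
  have hzero : |o.chartDensity c (extChartAt (𝓡 m) c x)| •
      f ((extChartAt (𝓡 m) c).symm (extChartAt (𝓡 m) c x)) = 0 :=
    Measure.eqOn_open_of_ae_eq hae (isOpen_extChartAt_target c) hcont continuousOn_const hxt
  rw [(extChartAt (𝓡 m) c).left_inv hx] at hzero
  exact (smul_eq_zero.1 hzero).resolve_left (abs_ne_zero.2 (o.chartDensity_ne_zero hxt))

end ManifoldOrientation

end ChartIntegral

section Integral

open MeasureTheory

variable {m : ℕ} {M : Type*} [TopologicalSpace M] [ChartedSpace (EuclideanSpace ℝ (Fin m)) M]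
  [IsManifold (𝓡 m) ∞ M] [T2Space M] [CompactSpace M]

variable (m M) in
lemma chartPartition_isSubordinate :
    (chartPartition m M).IsSubordinate fun c => (chartAt (EuclideanSpace ℝ (Fin m)) c).source :=
  (SmoothPartitionOfUnity.exists_isSubordinate_chartAt_source (𝓡 m) M).choose_spec

lemma tsupport_chartPartition_subset (c : M) :
    tsupport (chartPartition m M c) ⊆ (extChartAt (𝓡 m) c).source := by
  simpa only [extChartAt_source] using chartPartition_isSubordinate m M c

variable (m M) in
/-- The finitely many charts whose function in the partition of unity `chartPartition` is not
identically zero. -/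
def chartPartitionSupport : Finset M :=
  (chartPartition m M).locallyFinite.finite_nonempty_of_compact.toFinset

lemma chartPartition_eq_zero {c : M} (hc : c ∉ chartPartitionSupport m M) (x : M) :
    chartPartition m M c x = 0 :=
  of_not_not fun h => hc <|
    (chartPartition m M).locallyFinite.finite_nonempty_of_compact.mem_toFinset.2 ⟨x, h⟩

lemma sum_chartPartition (x : M) :
    ∑ c ∈ chartPartitionSupport m M, chartPartition m M c x = 1 := by
  rw [← (chartPartition m M).sum_eq_one (Set.mem_univ x), finsum_eq_sum_of_support_subset]
  exact fun c hc => of_not_not fun h => hc (chartPartition_eq_zero h x)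

variable [RiemannianBundle (fun x : M => TangentSpace (𝓡 m) x)]
  {E : Type*} [NormedAddCommGroup E] [NormedSpace ℝ E] (o : ManifoldOrientation m M)

namespace ManifoldOrientation

/-- The integral of a function over the compact manifold `M` against the Riemannian volume. -/
def integral (f : M → E) : E :=
  ∑ c ∈ chartPartitionSupport m M, o.chartIntegral c fun x => chartPartition m M c x • f x

lemma integralForm_eq_integral {η : ∀ x : M, (Fin m → TangentSpace (𝓡 m) x) → ℂ} {f : M → ℂ}
    (hη : ∀ x v, η x v = f x * ((o.volForm x v : ℝ) : ℂ)) : integralForm o η = o.integral f := by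
  have hchart (c : M) : (∫ z in (extChartAt (𝓡 m) c).target,
      ((chartPartition m M c ((extChartAt (𝓡 m) c).symm z) *
      (SignType.sign (o.volForm ((extChartAt (𝓡 m) c).symm z) (coordFrame c z)) : ℝ) : ℝ) : ℂ) *
      η ((extChartAt (𝓡 m) c).symm z) (coordFrame c z)) =
      o.chartIntegral c fun x => chartPartition m M c x • f x := by
    refine setIntegral_congr_fun (isOpen_extChartAt_target c).measurableSet fun z _ => ?_
    beta_reduce
    rw [hη, ← sign_mul_self (o.chartDensity c z), chartDensity]
    simp only [Complex.real_smul]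
    push_cast
    ring
  simp only [integralForm, hchart]
  refine finsum_eq_sum_of_support_subset _ fun c hc => of_not_not fun hcs => hc ?_
  simp [chartIntegral, chartPartition_eq_zero hcs]

lemma integrableOn_chartPartition_smul (c : M) {f : M → E} (hf : Continuous f) :
    IntegrableOn (fun z => |o.chartDensity c z| •
      (fun x => chartPartition m M c x • f x) ((extChartAt (𝓡 m) c).symm z))
      (extChartAt (𝓡 m) c).target :=
  o.integrableOn_chartDensity_smul
    ((chartPartition m M c).contMDiff.continuous.smul hf).continuousOn
    (isClosed_tsupport (chartPartition m M c)).isCompact (tsupport_chartPartition_subset c)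
    ((Function.support_smul_subset_left _ _).trans (subset_tsupport _))

lemma integral_sub {f g : M → E} (hf : Continuous f) (hg : Continuous g) :
    o.integral (f - g) = o.integral f - o.integral g := by
  simp only [integral, ← Finset.sum_sub_distrib]
  refine Finset.sum_congr rfl fun c _ => ?_
  rw [← o.chartIntegral_sub (o.integrableOn_chartPartition_smul c hf)
    (o.integrableOn_chartPartition_smul c hg)]
  congr 1
  ext x
  exact smul_sub _ _ _

lemma integral_smul {𝕜 : Type*} [NormedDivisionRing 𝕜] [Module 𝕜 E] [NormSMulClass 𝕜 E]
    [SMulCommClass ℝ 𝕜 E] (a : 𝕜) (f : M → E) : o.integral (a • f) = a • o.integral f := by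
  simp only [integral, chartIntegral, Finset.smul_sum, ← MeasureTheory.integral_smul, Pi.smul_apply]
  refine Finset.sum_congr rfl fun c _ => integral_congr_ae (.of_forall fun z => ?_)
  beta_reduce
  rw [smul_comm _ a, smul_comm _ a]

lemma integral_ofReal (f : M → ℝ) : o.integral (fun x => (f x : ℂ)) = (o.integral f : ℝ) := by
  simp only [integral, Complex.ofReal_sum, ← chartIntegral_ofReal, Complex.real_smul, smul_eq_mul,
    Complex.ofReal_mul]

lemma integral_nonneg {f : M → ℝ} (hf : 0 ≤ f) : 0 ≤ o.integral f :=
  Finset.sum_nonneg fun c _ => o.chartIntegral_nonneg c fun x =>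
    mul_nonneg ((chartPartition m M).nonneg c x) (hf x)

lemma integral_eq_zero_iff {f : M → ℝ} (hfc : Continuous f) (hf : 0 ≤ f) :
    o.integral f = 0 ↔ f = 0 := by
  have hnonneg (c : M) : 0 ≤ fun x => chartPartition m M c x • f x := fun x =>
    mul_nonneg ((chartPartition m M).nonneg c x) (hf x)
  refine ⟨fun h => funext fun x => ?_, fun h => by simp [h, integral, chartIntegral]⟩
  obtain ⟨c, hc, hcx⟩ : ∃ c ∈ chartPartitionSupport m M, chartPartition m M c x ≠ 0 :=
    Finset.exists_ne_zero_of_sum_ne_zero (by rw [sum_chartPartition]; exact one_ne_zero)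
  have hchart := (Finset.sum_eq_zero_iff_of_nonneg fun c _ =>
    o.chartIntegral_nonneg c (hnonneg c)).1 h c hc
  have hx := o.eq_zero_of_chartIntegral_eq_zero (hnonneg c)
    ((chartPartition m M c).contMDiff.continuous.smul hfc).continuousOn
    (o.integrableOn_chartPartition_smul c hfc) hchart
    (tsupport_chartPartition_subset c (subset_tsupport _ hcx))
  exact (mul_eq_zero.1 hx).resolve_left hcx

lemma integral_eq_chartIntegral {f : M → E} (hf : Continuous f) {c : M} {K : Set M}
    (hK : IsCompact K) (hKc : K ⊆ (extChartAt (𝓡 m) c).source) (hfK : Function.support f ⊆ K) :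
    o.integral f = o.chartIntegral c f := by
  have hchart (c' : M) : o.chartIntegral c' (fun x => chartPartition m M c' x • f x) =
      o.chartIntegral c fun x => chartPartition m M c' x • f x :=
    o.chartIntegral_eq_of_support_subset
      ((Function.support_smul_subset_left _ _).trans <|
        (subset_tsupport _).trans (tsupport_chartPartition_subset c'))
      ((Function.support_smul_subset_right _ _).trans (hfK.trans hKc))
  have hint (c' : M) : IntegrableOn (fun z => |o.chartDensity c z| •
      chartPartition m M c' ((extChartAt (𝓡 m) c).symm z) • f ((extChartAt (𝓡 m) c).symm z))
      (extChartAt (𝓡 m) c).target :=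
    o.integrableOn_chartDensity_smul (f := fun x => chartPartition m M c' x • f x)
      ((chartPartition m M c').contMDiff.continuous.smul hf).continuousOn hK hKc
      ((Function.support_smul_subset_right _ _).trans hfK)
  rw [integral, Finset.sum_congr rfl fun c' _ => hchart c']
  simp only [chartIntegral]
  rw [← integral_finsetSum _ fun c' _ => hint c']
  refine setIntegral_congr_fun (isOpen_extChartAt_target c).measurableSet fun z _ => ?_
  simp only [← Finset.smul_sum, ← Finset.sum_smul, sum_chartPartition, one_smul]

end ManifoldOrientation

end Integral

section FlatDerivative

variable {𝕜 : Type*} [NontriviallyNormedField 𝕜]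
  {V : Type*} [NormedAddCommGroup V] [NormedSpace 𝕜 V]
  {H : Type*} [TopologicalSpace H] {I : ModelWithCorners 𝕜 V H}
  {M : Type*} [TopologicalSpace M] [ChartedSpace H M]
  {F : Type*} [NormedAddCommGroup F] [NormedSpace 𝕜 F]

lemma mvfderiv_congr {f g : M → F} {x : M} (h : f =ᶠ[𝓝 x] g) :
    mvfderiv I f x = mvfderiv I g x := by
  simp only [mvfderiv, h.mfderiv_eq]
  rfl

variable {E : M → Type*} [TopologicalSpace (TotalSpace F E)] [∀ x, AddCommGroup (E x)]
  [∀ x, Module 𝕜 (E x)] [∀ x, TopologicalSpace (E x)] [FiberBundle F E] [VectorBundle 𝕜 F E]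
  (e : Trivialization F (TotalSpace.proj : TotalSpace F E → M)) [MemTrivializationAtlas e]

/-- The covariant derivative over the base set of a trivialization for which the constant sections
are parallel. -/
def flatDerivative (σ : ∀ x, E x) (x : M) : TangentSpace I x →L[𝕜] E x :=
  (e.symmL 𝕜 x) ∘L mvfderiv I (fun y => (e ⟨y, σ y⟩).2) x

lemma trivialization_flatDerivative {x : M} (hx : x ∈ e.baseSet) (σ : ∀ x, E x)
    (v : TangentSpace I x) :
    (e ⟨x, flatDerivative e σ x v⟩).2 = mvfderiv I (fun y => (e ⟨y, σ y⟩).2) x v := by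
  rw [flatDerivative, ContinuousLinearMap.comp_apply, e.symmL_apply hx, e.apply_mk_symm hx]

lemma flatDerivative_symm_const {x : M} (hx : x ∈ e.baseSet) (f : F) :
    flatDerivative (I := I) (𝕜 := 𝕜) e (fun y => e.symm y f) x = 0 := by
  have hconst : (fun y => (e ⟨y, e.symm y f⟩).2) =ᶠ[𝓝 x] fun _ => f := by
    filter_upwards [e.open_baseSet.mem_nhds hx] with y hy
    rw [e.apply_mk_symm hy]
  rw [flatDerivative, mvfderiv_congr hconst, mvfderiv_const, ContinuousLinearMap.comp_zero]

lemma isCovariantDerivativeOn_flatDerivative [IsManifold I 1 M] [∀ x, IsTopologicalAddGroup (E x)]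
    [∀ x, ContinuousSMul 𝕜 (E x)] [ContMDiffVectorBundle 1 F E I] :
    IsCovariantDerivativeOn (I := I) F (flatDerivative e) e.baseSet where
  add {σ σ' x} hσ hσ' hx := by
    have hadd : (fun y => (e ⟨y, (σ + σ') y⟩).2) =ᶠ[𝓝 x]
        (fun y => (e ⟨y, σ y⟩).2) + fun y => (e ⟨y, σ' y⟩).2 := by
      filter_upwards [e.open_baseSet.mem_nhds hx] with y hy
      exact (e.linear 𝕜 hy).map_add (σ y) (σ' y)
    rw [flatDerivative, mvfderiv_congr hadd,
      mvfderiv_add ((e.mdifferentiableAt_section_iff I σ hx).1 hσ)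
        ((e.mdifferentiableAt_section_iff I σ' hx).1 hσ'), ContinuousLinearMap.comp_add]
    rfl
  leibniz {σ g x} hσ hg hx := by
    have hsmul : (fun y => (e ⟨y, (g • σ) y⟩).2) =ᶠ[𝓝 x] g • fun y => (e ⟨y, σ y⟩).2 := by
      filter_upwards [e.open_baseSet.mem_nhds hx] with y hy
      exact (e.linear 𝕜 hy).map_smul (g y) (σ y)
    rw [flatDerivative, mvfderiv_congr hsmul,
      mvfderiv_smul hg ((e.mdifferentiableAt_section_iff I σ hx).1 hσ)]
    ext v
    simp only [ContinuousLinearMap.comp_add, ContinuousLinearMap.comp_smul, flatDerivative,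
      add_apply, smul_apply, ContinuousLinearMap.comp_apply, ContinuousLinearMap.smulRight_apply,
      map_smul]
    rw [e.symmL_apply hx (e ⟨x, σ x⟩).2, e.symm_apply_apply_mk hx]

lemma contMDiffAt_trivialization_symm_const {n : ℕ∞ω} [ContMDiffVectorBundle n F E I] {x : M}
    (hx : x ∈ e.baseSet) (f : F) :
    ContMDiffAt I (I.prod 𝓘(𝕜, F)) n (fun y => TotalSpace.mk' F y (e.symm y f)) x := by
  rw [e.contMDiffAt_section_iff hx]
  refine (contMDiffAt_const (c := f)).congr_of_eventuallyEq ?_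
  filter_upwards [e.open_baseSet.mem_nhds hx] with y hy
  rw [e.apply_mk_symm hy]

lemma mdifferentiableAt_trivialization_symm_const [ContMDiffVectorBundle 1 F E I] {x : M}
    (hx : x ∈ e.baseSet) (f : F) :
    MDifferentiableAt I (I.prod 𝓘(𝕜, F)) (fun y => TotalSpace.mk' F y (e.symm y f)) x :=
  (contMDiffAt_trivialization_symm_const e hx f).mdifferentiableAt one_ne_zero

end FlatDerivative

section LocalConnection

variable {m : ℕ} {M : Type*} [TopologicalSpace M] [ChartedSpace (EuclideanSpace ℝ (Fin m)) M]
  {F : Type*} [NormedAddCommGroup F] {E : M → Type*} [TopologicalSpace (TotalSpace F E)]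
  (e : Trivialization F (TotalSpace.proj : TotalSpace F E → M))

variable (m) in
/-- The part of the domain of the chart around `c` over which `e` trivializes the bundle, in
coordinates. -/
def localDomain (c : M) : Set (EuclideanSpace ℝ (Fin m)) :=
  (extChartAt (𝓡 m) c).target ∩ (extChartAt (𝓡 m) c).symm ⁻¹' e.baseSet

lemma isOpen_localDomain (c : M) : IsOpen (localDomain m e c) :=
  (continuousOn_extChartAt_symm c).isOpen_inter_preimage
    (isOpen_extChartAt_target c) e.open_baseSet

variable (m) in
/-- The coordinates of a section with respect to the trivialization `e` and the chart around
`c`. -/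
def localSection (c : M) (σ : ∀ x, E x) (z : EuclideanSpace ℝ (Fin m)) : F :=
  (e ⟨(extChartAt (𝓡 m) c).symm z, σ ((extChartAt (𝓡 m) c).symm z)⟩).2

variable [IsManifold (𝓡 m) ∞ M] [NormedSpace ℂ F] [∀ x, NormedAddCommGroup (E x)]
  [∀ x, InnerProductSpace ℂ (E x)] [FiberBundle F E] [VectorBundle ℝ F E]
  [ContMDiffVectorBundle ∞ F E (𝓡 m)]
  [MemTrivializationAtlas e]

lemma mvfderiv_trivialization_eq_fderiv_localSection {c : M} {z : EuclideanSpace ℝ (Fin m)}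
    (hz : z ∈ localDomain m e c) {σ : ∀ x, E x}
    (hσ : MDifferentiableAt (𝓡 m) ((𝓡 m).prod 𝓘(ℝ, F))
      (fun y => TotalSpace.mk' F y (σ y)) ((extChartAt (𝓡 m) c).symm z))
    (u : EuclideanSpace ℝ (Fin m)) :
    mvfderiv (𝓡 m) (fun y => (e ⟨y, σ y⟩).2) ((extChartAt (𝓡 m) c).symm z)
      (mfderiv 𝓘(ℝ, EuclideanSpace ℝ (Fin m)) (𝓡 m) (extChartAt (𝓡 m) c).symm z u) =
    fderiv ℝ (localSection m e c σ) z u := by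
  have hcomp := (((e.mdifferentiableAt_section_iff (𝓡 m) σ hz.2).1 hσ).hasMFDerivAt.comp z
    ((contMDiffAt_extChartAt_symm_target hz.1).mdifferentiableAt (by simp)).hasMFDerivAt).mfderiv
  rw [mfderiv_eq_fderiv] at hcomp
  exact (congrArg (fun L => L u) hcomp).symm

namespace ComplexConnection

variable (D : ComplexConnection m F E)

lemma toFun_symm_add {x : M} (hx : x ∈ e.baseSet) (f g : F) :
    D.toFun (fun y => e.symm y (f + g)) x =
      D.toFun (fun y => e.symm y f) x + D.toFun (fun y => e.symm y g) x := by
  have hdiff := mdifferentiableAt_trivialization_symm_const (I := 𝓡 m) (𝕜 := ℝ) e hx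
  rw [← D.isCovariantDerivativeOnUniv.add (hdiff f) (hdiff g)]
  refine D.isCovariantDerivativeOnUniv.congr_of_eventuallyEq (hdiff _)
    (mdifferentiableAt_add_section (hdiff f) (hdiff g)) Filter.univ_mem ?_
  filter_upwards [e.open_baseSet.mem_nhds hx] with y hy
  simpa only [e.symmL_apply hy, Pi.add_apply] using (e.symmL ℝ y).map_add f g

variable [VectorBundle ℂ F E]

lemma toFun_symm_smul {x : M} (hx : x ∈ e.baseSet) (a : ℂ) (f : F) (v : TangentSpace (𝓡 m) x) :
    D.toFun (fun y => e.symm y (a • f)) x v = a • D.toFun (fun y => e.symm y f) x v := by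
  have hdiff := mdifferentiableAt_trivialization_symm_const (I := 𝓡 m) (𝕜 := ℝ) e hx
  have hsmul : ∀ᶠ y in 𝓝 x, e.symm y (a • f) = a • e.symm y f := by
    filter_upwards [e.open_baseSet.mem_nhds hx] with y hy
    simpa only [e.symmL_apply hy] using (e.symmL ℂ y).map_smul a f
  rw [← D.smul_section a (hdiff f), D.isCovariantDerivativeOnUniv.congr_of_eventuallyEq (hdiff _)
    ((hdiff (a • f)).congr_of_eventuallyEq <| hsmul.mono fun y hy => by simp only [hy])
    Filter.univ_mem hsmul]

variable [FiniteDimensional ℂ F]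

/-- The endomorphism `f ↦ D_v f` of the typical fibre, where `f` is extended to a section that is
constant in the trivialization `e`. -/
def connEndomorphism {x : M} (hx : x ∈ e.baseSet) (v : TangentSpace (𝓡 m) x) : F →L[ℂ] F :=
  LinearMap.toContinuousLinearMap
    { toFun f := (e ⟨x, D.toFun (fun y => e.symm y f) x v⟩).2
      map_add' f g := by rw [D.toFun_symm_add e hx, add_apply, (e.linear ℝ hx).map_add]
      map_smul' a f := by rw [D.toFun_symm_smul e hx, (e.linear ℂ hx).map_smul, RingHom.id_apply] }

lemma connEndomorphism_apply {x : M} (hx : x ∈ e.baseSet) (v : TangentSpace (𝓡 m) x) (f : F) :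
    D.connEndomorphism e hx v f = (e ⟨x, D.toFun (fun y => e.symm y f) x v⟩).2 :=
  rfl

open Classical in
/-- The connection form of `D` with respect to the trivialization `e`, with the junk value `0`
outside the base set of `e`. -/
def connForm (x : M) : TangentSpace (𝓡 m) x →L[ℝ] (F →L[ℂ] F) :=
  haveI : T2Space (TangentSpace (𝓡 m) x) := inferInstanceAs (T2Space (EuclideanSpace ℝ (Fin m)))
  if hx : x ∈ e.baseSet then
    LinearMap.toContinuousLinearMap
      { toFun := D.connEndomorphism e hx
        map_add' u v := by
          ext f
          simp only [connEndomorphism_apply, map_add, (e.linear ℝ hx).map_add, add_apply]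
        map_smul' a v := by
          ext f
          simp only [connEndomorphism_apply, map_smul, (e.linear ℝ hx).map_smul, smul_apply,
            RingHom.id_apply] }
  else 0

lemma connForm_apply {x : M} (hx : x ∈ e.baseSet) (v : TangentSpace (𝓡 m) x) (f : F) :
    D.connForm e x v f = (e ⟨x, D.toFun (fun y => e.symm y f) x v⟩).2 := by
  rw [connForm, dif_pos hx]
  rfl

/-- The connection form of `D` with respect to the trivialization `e` and the chart around `c`. -/
def localConnForm (c : M) (z : EuclideanSpace ℝ (Fin m)) :
    EuclideanSpace ℝ (Fin m) →L[ℝ] (F →L[ℂ] F) :=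
  (D.connForm e ((extChartAt (𝓡 m) c).symm z)) ∘L
    (mfderiv 𝓘(ℝ, EuclideanSpace ℝ (Fin m)) (𝓡 m) (extChartAt (𝓡 m) c).symm z)

-- The difference of `D` and the flat derivative is tensorial, so that at `x` it can be evaluated on
-- the section through `σ x` that is constant in the trivialization.
lemma trivialization_apply_eq_mvfderiv_add_connForm {x : M} (hx : x ∈ e.baseSet) {σ : ∀ x, E x}
    (hσ : MDifferentiableAt (𝓡 m) ((𝓡 m).prod 𝓘(ℝ, F)) (fun y => TotalSpace.mk' F y (σ y)) x)
    (v : TangentSpace (𝓡 m) x) :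
    (e ⟨x, D.toFun σ x v⟩).2 =
      mvfderiv (𝓡 m) (fun y => (e ⟨y, σ y⟩).2) x v + D.connForm e x v (e ⟨x, σ x⟩).2 := by
  have hD := D.isCovariantDerivativeOnUniv.mono (Set.subset_univ e.baseSet)
  have hflat := isCovariantDerivativeOn_flatDerivative (I := 𝓡 m) (𝕜 := ℝ) e
  have hconst := IsCovariantDerivativeOn.difference_apply hD hflat hx
    (mdifferentiableAt_trivialization_symm_const (I := 𝓡 m) (𝕜 := ℝ) e hx (e ⟨x, σ x⟩).2)
  rw [flatDerivative_symm_const e hx, sub_zero, e.symm_apply_apply_mk hx,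
    IsCovariantDerivativeOn.difference_apply hD hflat hx hσ] at hconst
  rw [D.connForm_apply e hx, ← hconst, sub_apply, (e.linear ℝ hx).map_sub,
    trivialization_flatDerivative e hx, add_sub_cancel]

lemma trivialization_apply_eq_fderiv_add_localConnForm {c : M} {z : EuclideanSpace ℝ (Fin m)}
    (hz : z ∈ localDomain m e c) {σ : ∀ x, E x}
    (hσ : MDifferentiableAt (𝓡 m) ((𝓡 m).prod 𝓘(ℝ, F))
      (fun y => TotalSpace.mk' F y (σ y)) ((extChartAt (𝓡 m) c).symm z))
    (u : EuclideanSpace ℝ (Fin m)) :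
    (e ⟨(extChartAt (𝓡 m) c).symm z, D.toFun σ ((extChartAt (𝓡 m) c).symm z)
      (mfderiv 𝓘(ℝ, EuclideanSpace ℝ (Fin m)) (𝓡 m) (extChartAt (𝓡 m) c).symm z u)⟩).2 =
    fderiv ℝ (localSection m e c σ) z u + D.localConnForm e c z u (localSection m e c σ z) := by
  rw [D.trivialization_apply_eq_mvfderiv_add_connForm e hz.2 hσ,
    mvfderiv_trivialization_eq_fderiv_localSection e hz hσ]
  rfl

end ComplexConnection

end LocalConnection

lemma contDiffOn_of_forall_contDiffOn_apply {𝕜 𝕜' : Type*} [NontriviallyNormedField 𝕜]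
    [NontriviallyNormedField 𝕜'] [CompleteSpace 𝕜'] [NormedAlgebra 𝕜 𝕜'] {V F G : Type*}
    [NormedAddCommGroup V] [NormedSpace 𝕜 V] [NormedAddCommGroup F] [NormedSpace 𝕜' F]
    [FiniteDimensional 𝕜' F] [NormedAddCommGroup G] [NormedSpace 𝕜' G] [NormedSpace 𝕜 G]
    [IsScalarTower 𝕜 𝕜' G] {k : ℕ∞ω} {g : V → F →L[𝕜'] G} {s : Set V}
    (hg : ∀ f, ContDiffOn 𝕜 k (fun z => g z f) s) : ContDiffOn 𝕜 k g s := by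
  let b := Module.finBasis 𝕜' F
  have hsum : g = fun z => ∑ i, ((ContinuousLinearMap.smulRightL 𝕜' F G
      (LinearMap.toContinuousLinearMap (b.coord i))).restrictScalars 𝕜) (g z (b i)) := by
    funext z
    ext f
    conv_lhs => rw [← b.sum_repr f, map_sum]
    simp
  rw [hsum]
  exact ContDiffOn.sum fun i _ => (ContinuousLinearMap.contDiff _).comp_contDiffOn (hg (b i))

section LocalDerivative

variable {V F : Type*} [NormedAddCommGroup V] [NormedSpace ℝ V] [NormedAddCommGroup F]
  [NormedSpace ℂ F] {θ : V → V →L[ℝ] (F →L[ℂ] F)} {X Y : V → V} {s : V → F} {z : V}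

/-- The derivative `d_Y s + θ(Y) s` of the function `s` along the vector field `Y` with respect to
the connection `d + θ` of the trivial bundle with fibre `F`. -/
def localDerivative (θ : V → V →L[ℝ] (F →L[ℂ] F)) (Y : V → V) (s : V → F) (z : V) : F :=
  fderiv ℝ s z (Y z) + θ z (Y z) (s z)

lemma fderiv_localDerivative (hθ : DifferentiableAt ℝ θ z) (hY : DifferentiableAt ℝ Y z)
    (hs : ContDiffAt ℝ 2 s z) (u : V) :
    fderiv ℝ (localDerivative θ Y s) z u =
      fderiv ℝ (fderiv ℝ s) z u (Y z) + fderiv ℝ s z (fderiv ℝ Y z u) +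
        (fderiv ℝ θ z u (Y z) (s z) + θ z (fderiv ℝ Y z u) (s z) +
          θ z (Y z) (fderiv ℝ s z u)) := by
  have hds := ((hs.fderiv_right (m := 1) (by norm_num)).differentiableAt (by simp)).hasFDerivAt
  have hθY := (ContinuousLinearMap.restrictScalarsL ℂ F F ℝ ℝ).hasFDerivAt.comp z
    (hθ.hasFDerivAt.clm_apply hY.hasFDerivAt)
  have hsum := ((hds.clm_apply hY.hasFDerivAt).add
    (hθY.clm_apply (hs.differentiableAt (by simp)).hasFDerivAt)).fderiv
  refine (congrArg (fun L => L u) hsum).trans ?_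
  simp
  abel

lemma localDerivative_commutator (hθ : DifferentiableAt ℝ θ z) (hX : DifferentiableAt ℝ X z)
    (hY : DifferentiableAt ℝ Y z) (hs : ContDiffAt ℝ 2 s z) :
    localDerivative θ X (localDerivative θ Y s) z - localDerivative θ Y (localDerivative θ X s) z -
      localDerivative θ (VectorField.lieBracket ℝ X Y) s z =
    localCurvature θ z (X z) (Y z) (s z) := by
  have hsymm := (hs.isSymmSndFDerivAt (by simp)).eq (X z) (Y z)
  rw [localDerivative, localDerivative.eq_def θ Y (localDerivative θ X s),
    fderiv_localDerivative hθ hY hs, fderiv_localDerivative hθ hX hs, hsymm]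
  simp only [localDerivative, localCurvature, VectorField.lieBracket_eq, map_sub, map_add,
    sub_apply, add_apply, mul_apply_eq_comp]
  abel

end LocalDerivative

section ChartFields

variable {m : ℕ} {M : Type*} [TopologicalSpace M] [ChartedSpace (EuclideanSpace ℝ (Fin m)) M]

/-- The coordinates of a vector field in the chart around `c`. -/
def chartField (c : M) (X : ∀ x : M, TangentSpace (𝓡 m) x) (z : EuclideanSpace ℝ (Fin m)) :
    EuclideanSpace ℝ (Fin m) :=
  VectorField.mpullback 𝓘(ℝ, EuclideanSpace ℝ (Fin m)) (𝓡 m) (extChartAt (𝓡 m) c).symm X z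

variable [IsManifold (𝓡 m) ∞ M] {c : M} {z : EuclideanSpace ℝ (Fin m)}

/-- The vector field on the domain of the chart around `c` with constant coordinates `u`. -/
def coordField (c : M) (u : EuclideanSpace ℝ (Fin m)) (y : M) : TangentSpace (𝓡 m) y :=
  (trivializationAt (EuclideanSpace ℝ (Fin m)) (TangentSpace (𝓡 m)) c).symm y u

lemma contMDiffAt_coordField {x : M} (hx : x ∈ (extChartAt (𝓡 m) c).source)
    (u : EuclideanSpace ℝ (Fin m)) :
    ContMDiffAt (𝓡 m) ((𝓡 m).prod 𝓘(ℝ, EuclideanSpace ℝ (Fin m))) ∞ (T% (coordField c u)) x :=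
  contMDiffAt_trivialization_symm_const _ (by simpa using hx) u

lemma coordField_extChartAt_symm (hz : z ∈ (extChartAt (𝓡 m) c).target)
    (u : EuclideanSpace ℝ (Fin m)) :
    coordField c u ((extChartAt (𝓡 m) c).symm z) =
      mfderiv 𝓘(ℝ, EuclideanSpace ℝ (Fin m)) (𝓡 m) (extChartAt (𝓡 m) c).symm z u := by
  have hy : (extChartAt (𝓡 m) c).symm z ∈ (chartAt (EuclideanSpace ℝ (Fin m)) c).source := by
    simpa using (extChartAt (𝓡 m) c).map_target hz
  have hbase : (extChartAt (𝓡 m) c).symm z ∈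
      (trivializationAt (EuclideanSpace ℝ (Fin m)) (TangentSpace (𝓡 m)) c).baseSet := by
    simpa using hy
  have hsymmL := congrArg (fun L => L u) (TangentBundle.symmL_trivializationAt (I := 𝓡 m) hy)
  refine (Trivialization.symmL_apply (R := ℝ) _ hbase u).symm.trans (hsymmL.trans ?_)
  have hmf : ∀ w, w = z → (mfderivWithin 𝓘(ℝ, EuclideanSpace ℝ (Fin m)) (𝓡 m)
        (extChartAt (𝓡 m) c).symm (Set.range (𝓡 m)) w u : EuclideanSpace ℝ (Fin m)) =
      mfderiv 𝓘(ℝ, EuclideanSpace ℝ (Fin m)) (𝓡 m) (extChartAt (𝓡 m) c).symm z u := by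
    rintro w rfl
    rw [modelWithCornersSelf_coe, Set.range_id, mfderivWithin_univ]
  exact hmf _ ((extChartAt (𝓡 m) c).right_inv hz)

lemma differentiableAt_chartField {X : ∀ x : M, TangentSpace (𝓡 m) x}
    (hz : z ∈ (extChartAt (𝓡 m) c).target)
    (hX : ContMDiffAt (𝓡 m) ((𝓡 m).prod 𝓘(ℝ, EuclideanSpace ℝ (Fin m))) 1 (T% X)
      ((extChartAt (𝓡 m) c).symm z)) :
    DifferentiableAt ℝ (chartField c X) z :=
  (contMDiffAt_vectorSpace_iff_contDiffAt.1 <|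
    ContMDiffAt.mpullback_vectorField_preimage hX (contMDiffAt_extChartAt_symm_target hz)
      (isInvertible_mfderiv_extChartAt_symm hz)
      (by norm_num; exact ENat.LEInfty.out)).differentiableAt one_ne_zero

lemma mfderiv_extChartAt_symm_chartField (hz : z ∈ (extChartAt (𝓡 m) c).target)
    (X : ∀ x : M, TangentSpace (𝓡 m) x) :
    mfderiv 𝓘(ℝ, EuclideanSpace ℝ (Fin m)) (𝓡 m) (extChartAt (𝓡 m) c).symm z
      (chartField c X z) = X ((extChartAt (𝓡 m) c).symm z) :=
  (isInvertible_mfderiv_extChartAt_symm hz).self_apply_inverse _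

lemma chartField_eq_of_eq_mfderiv (hz : z ∈ (extChartAt (𝓡 m) c).target)
    {X : ∀ x : M, TangentSpace (𝓡 m) x} {u : EuclideanSpace ℝ (Fin m)}
    (hu : X ((extChartAt (𝓡 m) c).symm z) =
      mfderiv 𝓘(ℝ, EuclideanSpace ℝ (Fin m)) (𝓡 m) (extChartAt (𝓡 m) c).symm z u) :
    chartField c X z = u := by
  rw [chartField, VectorField.mpullback_apply, hu]
  exact (isInvertible_mfderiv_extChartAt_symm hz).inverse_apply_self _

lemma chartField_mlieBracket (hz : z ∈ (extChartAt (𝓡 m) c).target)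
    {X Y : ∀ x : M, TangentSpace (𝓡 m) x}
    (hX : MDifferentiableAt (𝓡 m) ((𝓡 m).prod 𝓘(ℝ, EuclideanSpace ℝ (Fin m))) (T% X)
      ((extChartAt (𝓡 m) c).symm z))
    (hY : MDifferentiableAt (𝓡 m) ((𝓡 m).prod 𝓘(ℝ, EuclideanSpace ℝ (Fin m))) (T% Y)
      ((extChartAt (𝓡 m) c).symm z)) :
    chartField c (VectorField.mlieBracket (𝓡 m) X Y) z =
      VectorField.lieBracket ℝ (chartField c X) (chartField c Y) z := by
  have : IsManifold (𝓡 m) (minSmoothness ℝ 2) M := by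
    rw [minSmoothness_of_isRCLikeNormedField]; infer_instance
  rw [chartField, VectorField.mpullback_mlieBracket hX hY (contMDiffAt_extChartAt_symm_target hz)
    (by rw [minSmoothness_of_isRCLikeNormedField]; exact ENat.LEInfty.out),
    ← VectorField.mlieBracketWithin_univ, VectorField.mlieBracketWithin_eq_lieBracketWithin]
  exact congrFun VectorField.lieBracketWithin_univ z

end ChartFields

section Smoothness

variable {m : ℕ} {M : Type*} [TopologicalSpace M] [ChartedSpace (EuclideanSpace ℝ (Fin m)) M]
  [IsManifold (𝓡 m) ∞ M] [T2Space M]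
  {F : Type*} [NormedAddCommGroup F] [NormedSpace ℂ F]
  {E : M → Type*} [TopologicalSpace (TotalSpace F E)]
  [∀ x, NormedAddCommGroup (E x)] [∀ x, InnerProductSpace ℂ (E x)]
  [FiberBundle F E] [VectorBundle ℝ F E] (D : ComplexConnection m F E)

-- `D.smooth` concerns sections that are smooth on all of `M`, hence the cut-off `f • σ`.
lemma ComplexConnection.contMDiffAt_toFun {σ : ∀ x, E x} {x : M} {s : Set M} (hs : s ∈ 𝓝 x)
    (hσ : ContMDiffOn (𝓡 m) ((𝓡 m).prod 𝓘(ℝ, F)) ∞ (fun y => TotalSpace.mk' F y (σ y)) s)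
    {Y : ∀ x : M, TangentSpace (𝓡 m) x} (hY : ContMDiffAt (𝓡 m)
      ((𝓡 m).prod 𝓘(ℝ, EuclideanSpace ℝ (Fin m))) ∞ (T% Y) x) :
    ContMDiffAt (𝓡 m) ((𝓡 m).prod 𝓘(ℝ, F)) ∞
      (fun y => TotalSpace.mk' F y (D.toFun σ y (Y y))) x := by
  obtain ⟨u, hus, huo, hxu⟩ := mem_nhds_iff.1 hs
  obtain ⟨f, -, hf⟩ := (SmoothBumpFunction.nhds_basis_tsupport (I := 𝓡 m) x).mem_iff.1
    (huo.mem_nhds hxu)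
  have hfσ := ContMDiffOn.smul_section_of_tsupport (n := ∞) (f.contMDiff.contMDiffOn (s := u))
    huo hf (hσ.mono hus)
  have hDfσ := D.smooth.contMDiff (σ := (f : M → ℝ) • σ) (by simpa using hfσ.contMDiffOn)
  refine ((hDfσ.contMDiffAt Filter.univ_mem).clm_bundle_apply hY).congr_of_eventuallyEq ?_
  filter_upwards [f.eventuallyEq_one.eventuallyEq_nhds, huo.mem_nhds hxu] with y hy hyu
  have hσy := ((hσ.mono hus).contMDiffAt (huo.mem_nhds hyu)).mdifferentiableAt (by simp)
  rw [D.isCovariantDerivativeOnUniv.congr_of_eventuallyEq (σ' := (f : M → ℝ) • σ) hσy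
    (hfσ.mdifferentiableAt (by simp)) Filter.univ_mem (hy.mono fun w hw => by simp [hw])]

end Smoothness

section LocalCurvature

variable {m : ℕ} {M : Type*} [TopologicalSpace M] [ChartedSpace (EuclideanSpace ℝ (Fin m)) M]
  [IsManifold (𝓡 m) ∞ M]
  {F : Type*} [NormedAddCommGroup F] [NormedSpace ℂ F]
  {E : M → Type*} [TopologicalSpace (TotalSpace F E)]
  [∀ x, NormedAddCommGroup (E x)] [∀ x, InnerProductSpace ℂ (E x)]
  [FiberBundle F E] [VectorBundle ℝ F E] [ContMDiffVectorBundle ∞ F E (𝓡 m)]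
  (e : Trivialization F (TotalSpace.proj : TotalSpace F E → M)) [MemTrivializationAtlas e]
  {c : M} {z : EuclideanSpace ℝ (Fin m)}

lemma contDiffAt_localSection {σ : ∀ x, E x} {k : ℕ∞ω} (hk : k ≤ ∞) (hz : z ∈ localDomain m e c)
    (hσ : ContMDiffAt (𝓡 m) ((𝓡 m).prod 𝓘(ℝ, F)) k (fun y => TotalSpace.mk' F y (σ y))
      ((extChartAt (𝓡 m) c).symm z)) :
    ContDiffAt ℝ k (localSection m e c σ) z := by
  have : IsManifold (𝓡 m) k M := IsManifold.of_le hk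
  have : ContMDiffVectorBundle k F E (𝓡 m) := ContMDiffVectorBundle.of_le hk
  exact contMDiffAt_iff_contDiffAt.1 <| ((e.contMDiffAt_section_iff hz.2).1 hσ).comp z
    ((contMDiffAt_extChartAt_symm_target hz.1).of_le hk)

namespace ComplexConnection

variable [VectorBundle ℂ F E] [FiniteDimensional ℂ F] (D : ComplexConnection m F E)

lemma localSection_toFun (hz : z ∈ localDomain m e c) {σ : ∀ x, E x}
    (hσ : MDifferentiableAt (𝓡 m) ((𝓡 m).prod 𝓘(ℝ, F))
      (fun y => TotalSpace.mk' F y (σ y)) ((extChartAt (𝓡 m) c).symm z))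
    (Y : ∀ x : M, TangentSpace (𝓡 m) x) :
    localSection m e c (fun y => D.toFun σ y (Y y)) z =
      localDerivative (D.localConnForm e c) (chartField c Y) (localSection m e c σ) z := by
  have hlocal := D.trivialization_apply_eq_fderiv_add_localConnForm e hz hσ (chartField c Y z)
  rwa [mfderiv_extChartAt_symm_chartField hz.1] at hlocal

lemma localSection_toFun_eventuallyEq (hz : z ∈ localDomain m e c) {σ : ∀ x, E x} {s : Set M}
    (hs : s ∈ 𝓝 ((extChartAt (𝓡 m) c).symm z))
    (hσ : ContMDiffOn (𝓡 m) ((𝓡 m).prod 𝓘(ℝ, F)) ∞ (fun y => TotalSpace.mk' F y (σ y)) s)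
    (Y : ∀ x : M, TangentSpace (𝓡 m) x) :
    localSection m e c (fun y => D.toFun σ y (Y y)) =ᶠ[𝓝 z]
      localDerivative (D.localConnForm e c) (chartField c Y) (localSection m e c σ) := by
  filter_upwards [(isOpen_localDomain e c).mem_nhds hz,
    (contMDiffAt_extChartAt_symm_target hz.1).continuousAt.eventually
      (eventually_mem_nhds_iff.2 hs)] with w hw hws
  exact D.localSection_toFun e hw ((hσ.contMDiffAt hws).mdifferentiableAt (by simp)) Y

variable [T2Space M]

lemma contDiffOn_localConnForm (c : M) :
    ContDiffOn ℝ ∞ (D.localConnForm e c) (localDomain m e c) := by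
  refine contDiffOn_clm_apply.2 fun u => contDiffOn_of_forall_contDiffOn_apply fun f z hz => ?_
  have hconst : ContMDiffOn (𝓡 m) ((𝓡 m).prod 𝓘(ℝ, F)) ∞
      (fun y => TotalSpace.mk' F y (e.symm y f)) e.baseSet := fun y hy =>
    (contMDiffAt_trivialization_symm_const e hy f).contMDiffWithinAt
  have hD := D.contMDiffAt_toFun (e.open_baseSet.mem_nhds hz.2) hconst
    (contMDiffAt_coordField ((extChartAt (𝓡 m) c).map_target hz.1) u)
  refine ContDiffAt.contDiffWithinAt <|
    (contDiffAt_localSection e le_rfl hz hD).congr_of_eventuallyEq ?_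
  filter_upwards [(isOpen_localDomain e c).mem_nhds hz] with w hw
  rw [localSection, coordField_extChartAt_symm hw.1]
  exact D.connForm_apply e hw.2 _ f

lemma localSection_toFun_toFun (hz : z ∈ localDomain m e c) {σ : ∀ x, E x} {s : Set M}
    (hs : s ∈ 𝓝 ((extChartAt (𝓡 m) c).symm z))
    (hσ : ContMDiffOn (𝓡 m) ((𝓡 m).prod 𝓘(ℝ, F)) ∞ (fun y => TotalSpace.mk' F y (σ y)) s)
    (X : ∀ x : M, TangentSpace (𝓡 m) x) {Y : ∀ x : M, TangentSpace (𝓡 m) x}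
    (hY : ContMDiffAt (𝓡 m) ((𝓡 m).prod 𝓘(ℝ, EuclideanSpace ℝ (Fin m))) 1 (T% Y)
      ((extChartAt (𝓡 m) c).symm z)) :
    localSection m e c (fun x => D.toFun (fun y => D.toFun σ y (Y y)) x (X x)) z =
      localDerivative (D.localConnForm e c) (chartField c X)
        (localDerivative (D.localConnForm e c) (chartField c Y) (localSection m e c σ)) z := by
  have hnear := D.localSection_toFun_eventuallyEq e hz hs hσ Y
  rw [D.localSection_toFun e hz (D.mdifferentiableAt_apply hs hσ hY), localDerivative,
    hnear.fderiv_eq, hnear.self_of_nhds]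
  rfl

lemma localSection_curvatureExpr (hz : z ∈ localDomain m e c)
    {X Y : ∀ x : M, TangentSpace (𝓡 m) x} {σ : ∀ x, E x} {s : Set M}
    (hX : ContMDiffAt (𝓡 m) ((𝓡 m).prod 𝓘(ℝ, EuclideanSpace ℝ (Fin m))) 1 (T% X)
      ((extChartAt (𝓡 m) c).symm z))
    (hY : ContMDiffAt (𝓡 m) ((𝓡 m).prod 𝓘(ℝ, EuclideanSpace ℝ (Fin m))) 1 (T% Y)
      ((extChartAt (𝓡 m) c).symm z))
    (hs : s ∈ 𝓝 ((extChartAt (𝓡 m) c).symm z))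
    (hσ : ContMDiffOn (𝓡 m) ((𝓡 m).prod 𝓘(ℝ, F)) ∞ (fun y => TotalSpace.mk' F y (σ y)) s) :
    localSection m e c (D.curvatureExpr X Y σ) z =
      localCurvature (D.localConnForm e c) z (chartField c X z) (chartField c Y z)
        (localSection m e c σ z) := by
  have hσz := hσ.contMDiffAt hs
  have hθ := ((D.contDiffOn_localConnForm e c).contDiffAt
    ((isOpen_localDomain e c).mem_nhds hz)).differentiableAt (by simp)
  have hbracket := D.localSection_toFun e hz (hσz.mdifferentiableAt (by simp))
    (VectorField.mlieBracket (𝓡 m) X Y)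
  rw [localDerivative, chartField_mlieBracket hz.1 (hX.mdifferentiableAt one_ne_zero)
    (hY.mdifferentiableAt one_ne_zero)] at hbracket
  rw [← localDerivative_commutator hθ (differentiableAt_chartField hz.1 hX)
    (differentiableAt_chartField hz.1 hY)
    (contDiffAt_localSection e ENat.LEInfty.out hz (hσz.of_le ENat.LEInfty.out)),
    ← D.localSection_toFun_toFun e hz hs hσ X hY, ← D.localSection_toFun_toFun e hz hs hσ Y hX,
    localDerivative.eq_def _ (VectorField.lieBracket ℝ _ _), ← hbracket]
  simp only [localSection, curvatureExpr, (e.linear ℝ hz.2).map_sub]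

lemma trivialization_curvature_eq_localCurvature (hz : z ∈ localDomain m e c)
    (w : Fin 2 → EuclideanSpace ℝ (Fin m)) (s : E ((extChartAt (𝓡 m) c).symm z)) :
    e.continuousLinearEquivAt ℂ _ hz.2 (D.curvature ((extChartAt (𝓡 m) c).symm z)
      (fun i => mfderiv 𝓘(ℝ, EuclideanSpace ℝ (Fin m)) (𝓡 m) (extChartAt (𝓡 m) c).symm z (w i))
        s) =
      localCurvature (D.localConnForm e c) z (w 0) (w 1)
        (e.continuousLinearEquivAt ℂ _ hz.2 s) := by
  obtain ⟨a, ha, hσ⟩ := FiberBundle.exists_contMDiffOn_extend (k := ∞) (𝓡 m) F s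
  let X : Fin 2 → TangentSpace (𝓡 m) ((extChartAt (𝓡 m) c).symm z) := fun i =>
    mfderiv 𝓘(ℝ, EuclideanSpace ℝ (Fin m)) (𝓡 m) (extChartAt (𝓡 m) c).symm z (w i)
  have hcurv := D.localSection_curvatureExpr e hz
    (FiberBundle.contMDiffAt_extend (k := 1) (𝓡 m) (EuclideanSpace ℝ (Fin m)) (X 0))
    (FiberBundle.contMDiffAt_extend (k := 1) (𝓡 m) (EuclideanSpace ℝ (Fin m)) (X 1)) ha hσ
  rw [chartField_eq_of_eq_mfderiv hz.1 (u := w 0) (FiberBundle.extend_apply_self _ _),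
    chartField_eq_of_eq_mfderiv hz.1 (u := w 1) (FiberBundle.extend_apply_self _ _)] at hcurv
  simp only [localSection, FiberBundle.extend_apply_self] at hcurv
  exact hcurv

end ComplexConnection

end LocalCurvature

section CurvatureForm

lemma extChartAt_self_mem_localDomain {m : ℕ} {M : Type*} [TopologicalSpace M]
    [ChartedSpace (EuclideanSpace ℝ (Fin m)) M] {F : Type*} [NormedAddCommGroup F]
    {E : M → Type*} [TopologicalSpace (TotalSpace F E)] [∀ x, TopologicalSpace (E x)]
    [FiberBundle F E] (x : M) :
    extChartAt (𝓡 m) x x ∈ localDomain m (trivializationAt F E x) x := by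
  refine ⟨mem_extChartAt_target x, ?_⟩
  rw [Set.mem_preimage, extChartAt_to_inv]
  exact FiberBundle.mem_baseSet_trivializationAt' x


variable {m : ℕ} {M : Type*} [TopologicalSpace M] [ChartedSpace (EuclideanSpace ℝ (Fin m)) M]
  [IsManifold (𝓡 m) ∞ M] [T2Space M]
  {F : Type*} [NormedAddCommGroup F] [NormedSpace ℂ F] [FiniteDimensional ℂ F]
  {E : M → Type*} [TopologicalSpace (TotalSpace F E)]
  [∀ x, NormedAddCommGroup (E x)] [∀ x, InnerProductSpace ℂ (E x)]
  [FiberBundle F E] [VectorBundle ℂ F E] [VectorBundle ℝ F E]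
  [ContMDiffVectorBundle ∞ F E (𝓡 m)]

variable (F) in
/-- The trace of endomorphisms, as a continuous real linear map. -/
def endTrace : (F →L[ℂ] F) →L[ℝ] ℂ :=
  (LinearMap.toContinuousLinearMap
    (LinearMap.trace ℂ F ∘ₗ ContinuousLinearMap.coeLM ℂ)).restrictScalars ℝ

lemma endTrace_mul_comm (a b : F →L[ℂ] F) : endTrace F (a * b) = endTrace F (b * a) :=
  LinearMap.trace_mul_comm ℂ a.toLinearMap b.toLinearMap

/-- The local curvature as an alternating form. -/
def localCurvatureForm {V 𝔸 : Type*} [NormedAddCommGroup V] [NormedSpace ℝ V] [NormedRing 𝔸]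
    [NormedAlgebra ℝ 𝔸] (θ : V → V →L[ℝ] 𝔸) (z : V) : V [⋀^Fin 2]→ₗ[ℝ] 𝔸 where
  toFun w := localCurvature θ z (w 0) (w 1)
  map_update_add' w i a b := by
    fin_cases i <;> simp [localCurvature, mul_add, add_mul] <;> abel
  map_update_smul' w i r a := by
    fin_cases i <;> simp [localCurvature, smul_add, smul_sub]
  map_eq_zero_of_eq' w i j hij hne := by
    have hw : w 0 = w 1 := by
      fin_cases i <;> fin_cases j <;> simp_all
    simp [localCurvature, hw]

namespace ComplexConnection

variable (D : ComplexConnection m F E)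
  (e : Trivialization F (TotalSpace.proj : TotalSpace F E → M)) [MemTrivializationAtlas e]
  {c : M} {z : EuclideanSpace ℝ (Fin m)}

lemma curvature_eq_conj_localCurvature (hz : z ∈ localDomain m e c)
    (w : Fin 2 → EuclideanSpace ℝ (Fin m)) :
    D.curvature ((extChartAt (𝓡 m) c).symm z)
      (fun i => mfderiv 𝓘(ℝ, EuclideanSpace ℝ (Fin m)) (𝓡 m) (extChartAt (𝓡 m) c).symm z (w i)) =
    (e.continuousLinearEquivAt ℂ _ hz.2).symm.toLinearEquiv.conj
      (localCurvature (D.localConnForm e c) z (w 0) (w 1)).toLinearMap := by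
  ext s
  apply (e.continuousLinearEquivAt ℂ _ hz.2).injective
  rw [D.trivialization_curvature_eq_localCurvature e hz w s]
  exact ((e.continuousLinearEquivAt ℂ _ hz.2).apply_symm_apply _).symm

lemma trace_curvature_comp (hz : z ∈ localDomain m e c)
    (w w' : Fin 2 → EuclideanSpace ℝ (Fin m)) :
    LinearMap.trace ℂ (E ((extChartAt (𝓡 m) c).symm z))
      (D.curvature _ (fun i => mfderiv 𝓘(ℝ, EuclideanSpace ℝ (Fin m)) (𝓡 m)
          (extChartAt (𝓡 m) c).symm z (w i)) ∘ₗ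
        D.curvature _ (fun i => mfderiv 𝓘(ℝ, EuclideanSpace ℝ (Fin m)) (𝓡 m)
          (extChartAt (𝓡 m) c).symm z (w' i))) =
      endTrace F (localCurvature (D.localConnForm e c) z (w 0) (w 1) *
        localCurvature (D.localConnForm e c) z (w' 0) (w' 1)) := by
  rw [D.curvature_eq_conj_localCurvature e hz, D.curvature_eq_conj_localCurvature e hz,
    ← LinearEquiv.conj_comp, LinearMap.trace_conj']
  rfl

lemma exists_alternatingMap_eq_curvature_extChartAt_symm (hz : z ∈ localDomain m e c) :
    ∃ α : TangentSpace (𝓡 m) ((extChartAt (𝓡 m) c).symm z) [⋀^Fin 2]→ₗ[ℝ]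
      (E ((extChartAt (𝓡 m) c).symm z) →ₗ[ℂ] E ((extChartAt (𝓡 m) c).symm z)),
      ⇑α = D.curvature ((extChartAt (𝓡 m) c).symm z) := by
  obtain ⟨L, hL⟩ := isInvertible_mfderiv_extChartAt_symm hz.1
  let T := (e.continuousLinearEquivAt ℂ _ hz.2).symm.toLinearEquiv
  refine ⟨((T.conj.toLinearMap ∘ₗ ContinuousLinearMap.coeLM ℂ).restrictScalars ℝ).compAlternatingMap
    ((localCurvatureForm (D.localConnForm e c) z).compLinearMap L.symm.toLinearMap), ?_⟩
  funext w
  refine (D.curvature_eq_conj_localCurvature e hz fun i => L.symm (w i)).symm.trans ?_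
  congr with i
  rw [← hL]
  exact L.apply_symm_apply (w i)

lemma exists_alternatingMap_eq_curvature (x : M) :
    ∃ α : TangentSpace (𝓡 m) x [⋀^Fin 2]→ₗ[ℝ] (E x →ₗ[ℂ] E x), ⇑α = D.curvature x := by
  have hx := D.exists_alternatingMap_eq_curvature_extChartAt_symm (trivializationAt F E x)
    (extChartAt_self_mem_localDomain x)
  rwa [extChartAt_to_inv] at hx

end ComplexConnection

end CurvatureForm

section ChernForm

variable {n : ℕ} {M : Type*} [TopologicalSpace M]
  [ChartedSpace (EuclideanSpace ℝ (Fin (4 + n))) M]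
  [IsManifold (𝓡 (4 + n)) ∞ M] [T2Space M]
  {F : Type*} [NormedAddCommGroup F] [NormedSpace ℂ F]
  {E : M → Type*} [TopologicalSpace (TotalSpace F E)]
  [∀ x, NormedAddCommGroup (E x)] [∀ x, InnerProductSpace ℂ (E x)]
  [FiberBundle F E] [VectorBundle ℂ F E] [VectorBundle ℝ F E]
  [ContMDiffVectorBundle ∞ F E (𝓡 (4 + n))]

/-- The standard basis of the model space, as a basis of a tangent space. -/
def tangentBasis {m : ℕ} {M : Type*} [TopologicalSpace M]
    [ChartedSpace (EuclideanSpace ℝ (Fin m)) M] (x : M) :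
    Module.Basis (Fin m) ℝ (TangentSpace (𝓡 m) x) :=
  (EuclideanSpace.basisFun (Fin m) ℝ).toBasis

namespace ComplexConnection

variable (D : ComplexConnection (4 + n) F E)
  (Φ : ∀ x : M, TangentSpace (𝓡 (4 + n)) x [⋀^Fin n]→L[ℝ] ℝ)

/-- The form `Tr (F_D ∧ F_D) ∧ Φ` of top degree, which represents the class of `-8π² ch₂(E) Φ`. -/
def chernForm (x : M) : (Fin (4 + n) → TangentSpace (𝓡 (4 + n)) x) → ℂ :=
  wedge (· * ·) (D.traceSq x) fun w => ((Φ x w : ℝ) : ℂ)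

section ChernDensity

variable [RiemannianBundle (fun x : M => TangentSpace (𝓡 (4 + n)) x)]
  (o : ManifoldOrientation (4 + n) M)

/-- The function `f` with `Tr (F_D ∧ F_D) ∧ Φ = f ν_M`, computed as the quotient of the two sides
on the standard basis of the model space. -/
def chernDensity (x : M) : ℂ :=
  D.chernForm Φ x (tangentBasis x) / (o.volForm x (tangentBasis x) : ℝ)

variable {D Φ o} in
lemma chernDensity_eq {x : M} {a : ℂ}
    (ha : ∀ v, D.chernForm Φ x v = a * ((o.volForm x v : ℝ) : ℂ)) : D.chernDensity Φ o x = a := by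
  have hν : o.volForm x (tangentBasis x) ≠ 0 := volumeForm_basis_ne_zero (o.orient x) _
  rw [chernDensity, ha, mul_div_cancel_right₀ _ (by exact_mod_cast hν)]

variable {Φ o D} in
lemma IsFlat.chernDensity_eq_zero (hD : D.IsFlat) :
    D.chernDensity Φ o = 0 := by
  funext x
  have hcurv : D.curvature x = fun _ => 0 := funext (hD x)
  exact chernDensity_eq fun v => by simp [chernForm, traceSq, wedge, hcurv]

end ChernDensity

variable [FiniteDimensional ℂ F]

lemma chernForm_coordFrame (e : Trivialization F (TotalSpace.proj : TotalSpace F E → M))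
    [MemTrivializationAtlas e] {c : M} {z : EuclideanSpace ℝ (Fin (4 + n))}
    (hz : z ∈ localDomain (4 + n) e c) :
    D.chernForm Φ ((extChartAt (𝓡 (4 + n)) c).symm z) (coordFrame c z) =
      (((2).factorial * (2).factorial * n.factorial : ℕ) : ℂ)⁻¹ *
        alternation (fun i => EuclideanSpace.single i (1 : ℝ))
          (chernWeil (endTrace F) (D.localConnForm e c) (formInChart Φ c) z) := by
  refine (wedge_wedge_eq_alternation _ _ _ _ _).trans (congrArg _ ?_)
  simp only [alternation_apply]
  refine Finset.sum_congr rfl fun σ _ => congrArg _ ?_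
  exact congrArg₂ (· * ·) (D.trace_curvature_comp e hz _ _) rfl

lemma exists_alternatingMap_eq_traceSq (x : M) :
    ∃ η : TangentSpace (𝓡 (4 + n)) x [⋀^Fin (2 + 2)]→ₗ[ℝ] ℂ, ⇑η = D.traceSq x := by
  obtain ⟨α, hα⟩ := D.exists_alternatingMap_eq_curvature x
  obtain ⟨η, hη⟩ := exists_alternatingMap_eq_wedge
    (((LinearMap.mul ℂ (E x →ₗ[ℂ] E x)).compr₂ (LinearMap.trace ℂ (E x))).restrictScalars₁₂ ℝ ℝ)
    α.toMultilinearMap α.toMultilinearMap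
  exact ⟨η, hη.trans (by rw [traceSq, ← hα]; rfl)⟩

lemma exists_alternatingMap_eq_chernForm (x : M) :
    ∃ η : TangentSpace (𝓡 (4 + n)) x [⋀^Fin (4 + n)]→ₗ[ℝ] ℂ, ⇑η = D.chernForm Φ x := by
  obtain ⟨η, hη⟩ := D.exists_alternatingMap_eq_traceSq x
  obtain ⟨ζ, hζ⟩ := exists_alternatingMap_eq_wedge (LinearMap.mul ℝ ℂ) η.toMultilinearMap
    (Complex.ofRealCLM.toLinearMap.compMultilinearMap (Φ x).toAlternatingMap.toMultilinearMap)
  exact ⟨ζ, hζ.trans (by rw [chernForm, ← hη]; rfl)⟩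

lemma continuousOn_alternation_chernWeil {Φ} (hΦ : IsSmoothForm Φ)
    (e : Trivialization F (TotalSpace.proj : TotalSpace F E → M)) [MemTrivializationAtlas e]
    (c : M) (b : Fin (4 + n) → EuclideanSpace ℝ (Fin (4 + n))) :
    ContinuousOn (fun z => alternation b
      (chernWeil (endTrace F) (D.localConnForm e c) (formInChart Φ c) z))
      (localDomain (4 + n) e c) := by
  simp only [alternation_apply]
  refine continuousOn_finsetSum _ fun σ _ => ContinuousOn.const_smul ?_ _
  exact (contDiffOn_chernWeil (isOpen_localDomain e c) (D.contDiffOn_localConnForm e c)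
    ((hΦ c).mono Set.inter_subset_left) _).continuousOn

variable [RiemannianBundle (fun x : M => TangentSpace (𝓡 (4 + n)) x)]
  (o : ManifoldOrientation (4 + n) M)

lemma chernForm_eq_chernDensity_mul (x : M) (v : Fin (4 + n) → TangentSpace (𝓡 (4 + n)) x) :
    D.chernForm Φ x v = D.chernDensity Φ o x * ((o.volForm x v : ℝ) : ℂ) := by
  have hν : o.volForm x (tangentBasis x) ≠ 0 := volumeForm_basis_ne_zero (o.orient x) _
  obtain ⟨η, hη⟩ := D.exists_alternatingMap_eq_chernForm Φ x
  obtain ⟨a, ha⟩ := exists_alternatingMap_eq_mul (tangentBasis x) hν η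
  rw [hη] at ha
  rw [chernDensity_eq ha, ha]

lemma chernDensity_mul_chartDensity (e : Trivialization F (TotalSpace.proj : TotalSpace F E → M))
    [MemTrivializationAtlas e] {c : M} {z : EuclideanSpace ℝ (Fin (4 + n))}
    (hz : z ∈ localDomain (4 + n) e c) :
    D.chernDensity Φ o ((extChartAt (𝓡 (4 + n)) c).symm z) * (o.chartDensity c z : ℝ) =
      (((2).factorial * (2).factorial * n.factorial : ℕ) : ℂ)⁻¹ *
        alternation (fun i => EuclideanSpace.single i (1 : ℝ))
          (chernWeil (endTrace F) (D.localConnForm e c) (formInChart Φ c) z) := by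
  rw [← D.chernForm_coordFrame Φ e hz, D.chernForm_eq_chernDensity_mul Φ o]
  rfl

variable {Φ}

lemma continuousOn_chernDensity_extChartAt_symm (hΦ : IsSmoothForm Φ)
    (e : Trivialization F (TotalSpace.proj : TotalSpace F E → M)) [MemTrivializationAtlas e]
    (c : M) : ContinuousOn (fun z => D.chernDensity Φ o ((extChartAt (𝓡 (4 + n)) c).symm z))
      (localDomain (4 + n) e c) := by
  have hne {z} (hz : z ∈ localDomain (4 + n) e c) : ((o.chartDensity c z : ℝ) : ℂ) ≠ 0 :=
    Complex.ofReal_ne_zero.2 (o.chartDensity_ne_zero hz.1)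
  have hdensity : ContinuousOn (fun z => ((o.chartDensity c z : ℝ) : ℂ))
      (localDomain (4 + n) e c) :=
    Complex.continuous_ofReal.comp_continuousOn
      ((o.continuousOn_chartDensity c).mono Set.inter_subset_left)
  exact ((continuousOn_const.mul (D.continuousOn_alternation_chernWeil hΦ e c _)).div hdensity
    fun z hz => hne hz).congr fun z hz =>
      eq_div_of_mul_eq (hne hz) (D.chernDensity_mul_chartDensity Φ o e hz)

lemma continuous_chernDensity (hΦ : IsSmoothForm Φ) : Continuous (D.chernDensity Φ o) := by
  refine continuous_iff_continuousAt.2 fun x => ?_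
  have hchart : ContinuousAt (D.chernDensity Φ o ∘ (extChartAt (𝓡 (4 + n)) x).symm)
      (extChartAt (𝓡 (4 + n)) x x) :=
    (D.continuousOn_chernDensity_extChartAt_symm o hΦ (trivializationAt F E x) x).continuousAt
      ((isOpen_localDomain _ x).mem_nhds (extChartAt_self_mem_localDomain x))
  have hcomp : ContinuousAt ((D.chernDensity Φ o ∘ (extChartAt (𝓡 (4 + n)) x).symm) ∘
      extChartAt (𝓡 (4 + n)) x) x := hchart.comp (continuousAt_extChartAt x)
  refine hcomp.congr ?_
  filter_upwards [extChartAt_source_mem_nhds (I := 𝓡 (4 + n)) x] with y hy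
  exact congrArg (D.chernDensity Φ o) ((extChartAt (𝓡 (4 + n)) x).left_inv hy)

end ComplexConnection

end ChernForm

section Locality

variable {m : ℕ} {M : Type*} [TopologicalSpace M] [ChartedSpace (EuclideanSpace ℝ (Fin m)) M]
  [IsManifold (𝓡 m) ∞ M]
  {F : Type*} [NormedAddCommGroup F] [NormedSpace ℂ F]
  {E : M → Type*} [TopologicalSpace (TotalSpace F E)]
  [∀ x, NormedAddCommGroup (E x)] [∀ x, InnerProductSpace ℂ (E x)]
  [FiberBundle F E] [VectorBundle ℝ F E]

namespace ComplexConnection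

/-- The affine combination `g A + (1 - g) D` of two connections. -/
def interpolate (D A : ComplexConnection m F E) (g : C^∞⟮𝓡 m, M; ℝ⟯) :
    ComplexConnection m F E where
  toCovariantDerivative :=
    CovariantDerivative.affineCombination A.toCovariantDerivative D.toCovariantDerivative g
  smooth := ContMDiffCovariantDerivativeOn.affine_combination g.contMDiff.contMDiffOn
    A.smooth D.smooth
  smul_section a {σ x} hσ v := by
    change g x • A.toFun _ x v + (1 - g x) • D.toFun _ x v =
      a • (g x • A.toFun σ x v + (1 - g x) • D.toFun σ x v)
    rw [A.smul_section a hσ, D.smul_section a hσ, smul_add, smul_comm a (g x),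
      smul_comm a (1 - g x)]

lemma interpolate_apply (D A : ComplexConnection m F E) (g : C^∞⟮𝓡 m, M; ℝ⟯) (σ : ∀ x, E x)
    (x : M) : (interpolate D A g).toFun σ x = g x • A.toFun σ x + (1 - g x) • D.toFun σ x :=
  rfl

variable [VectorBundle ℂ F E] [ContMDiffVectorBundle ∞ F E (𝓡 m)]

lemma curvature_congr [T2Space M] {D D' : ComplexConnection m F E} {x : M}
    (h : ∀ᶠ y in 𝓝 x, ∀ σ, D.toFun σ y = D'.toFun σ y) :
    D.curvature x = D'.curvature x := by
  refine funext fun w => LinearMap.ext fun s => ?_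
  obtain ⟨a, ha, hσ⟩ := FiberBundle.exists_contMDiffOn_extend (k := ∞) (𝓡 m) F s
  have hiterated (u v : TangentSpace (𝓡 m) x) :
      D.toFun (fun y => D.toFun (FiberBundle.extend F s) y
        (FiberBundle.extend (EuclideanSpace ℝ (Fin m)) u y)) x v =
      D'.toFun (fun y => D'.toFun (FiberBundle.extend F s) y
        (FiberBundle.extend (EuclideanSpace ℝ (Fin m)) u y)) x v := by
    have hu := FiberBundle.contMDiffAt_extend (k := 1) (𝓡 m) (EuclideanSpace ℝ (Fin m)) u
    rw [← h.self_of_nhds, D.isCovariantDerivativeOnUniv.congr_of_eventuallyEq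
      (D.mdifferentiableAt_apply ha hσ hu) (D'.mdifferentiableAt_apply ha hσ hu) Filter.univ_mem]
    filter_upwards [h] with y hy
    rw [hy]
  change D.curvatureExpr _ _ _ x = D'.curvatureExpr _ _ _ x
  rw [curvatureExpr, curvatureExpr, FiberBundle.extend_apply_self,
    FiberBundle.extend_apply_self, hiterated, hiterated, h.self_of_nhds]

lemma connForm_congr [FiniteDimensional ℂ F] {D D' : ComplexConnection m F E}
    (e : Trivialization F (TotalSpace.proj : TotalSpace F E → M)) [MemTrivializationAtlas e] {x : M}
    (h : ∀ σ, D.toFun σ x = D'.toFun σ x) : D.connForm e x = D'.connForm e x := by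
  by_cases hx : x ∈ e.baseSet
  · ext v f
    rw [D.connForm_apply e hx, D'.connForm_apply e hx, h]
  · simp only [connForm, dif_neg hx]

end ComplexConnection

end Locality

lemma exists_contMDiffMap_sum_eq_one {m : ℕ} {M : Type*} [TopologicalSpace M]
    [ChartedSpace (EuclideanSpace ℝ (Fin m)) M] [IsManifold (𝓡 m) ∞ M] [T2Space M] [CompactSpace M]
    {ι : Type*} {U : ι → Set M} (hU : ∀ i, IsOpen (U i)) (hcover : ⋃ i, U i = Set.univ) :
    ∃ (S : Finset ι) (ψ : ι → C^∞⟮𝓡 m, M; ℝ⟯), ∑ i ∈ S, ψ i = 1 ∧ ∀ i, tsupport (ψ i) ⊆ U i := by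
  obtain ⟨ψ, hψ⟩ := SmoothPartitionOfUnity.exists_isSubordinate (𝓡 m) isClosed_univ U hU
    hcover.ge
  have hfin : {i | (Function.support (ψ i)).Nonempty}.Finite :=
    ψ.locallyFinite.finite_nonempty_of_compact
  refine ⟨hfin.toFinset, ψ, ContMDiffMap.ext fun x => ?_, hψ⟩
  refine (map_sum (ContMDiffMap.evalRingHom x) _ _).trans ?_
  refine (finsum_eq_sum_of_support_subset _ fun i hi => ?_).symm.trans
    (ψ.sum_eq_one (Set.mem_univ x))
  exact hfin.mem_toFinset.2 ⟨x, hi⟩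

section SignOfDensity

variable {m : ℕ} {M : Type*} [TopologicalSpace M] [ChartedSpace (EuclideanSpace ℝ (Fin m)) M]
  [IsManifold (𝓡 m) ∞ M] [RiemannianBundle (fun x : M => TangentSpace (𝓡 m) x)]

lemma ManifoldOrientation.eventually_sign_chartDensity_eq (o : ManifoldOrientation m M) {c : M}
    {z : EuclideanSpace ℝ (Fin m)} (hz : z ∈ (extChartAt (𝓡 m) c).target) :
    ∀ᶠ y in 𝓝 z, SignType.sign (o.chartDensity c y) = SignType.sign (o.chartDensity c z) := by
  have hsign := (continuousAt_sign_of_ne_zero (o.chartDensity_ne_zero hz)).comp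
    ((o.continuousOn_chartDensity c).continuousAt ((isOpen_extChartAt_target c).mem_nhds hz))
  exact (hsign.eventually (mem_nhds_discrete.2 rfl)).mono fun _ hy => hy.symm

end SignOfDensity

section Independence

open MeasureTheory

variable {n : ℕ} {M : Type*} [TopologicalSpace M]
  [ChartedSpace (EuclideanSpace ℝ (Fin (4 + n))) M]
  [IsManifold (𝓡 (4 + n)) ∞ M] [T2Space M]
  {F : Type*} [NormedAddCommGroup F] [NormedSpace ℂ F]
  {E : M → Type*} [TopologicalSpace (TotalSpace F E)]
  [∀ x, NormedAddCommGroup (E x)] [∀ x, InnerProductSpace ℂ (E x)]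
  [FiberBundle F E] [VectorBundle ℂ F E] [VectorBundle ℝ F E]
  [ContMDiffVectorBundle ∞ F E (𝓡 (4 + n))]
  [RiemannianBundle (fun x : M => TangentSpace (𝓡 (4 + n)) x)]
  {o : ManifoldOrientation (4 + n) M}
  {Φ : ∀ x : M, TangentSpace (𝓡 (4 + n)) x [⋀^Fin n]→L[ℝ] ℝ}

namespace ComplexConnection

lemma chernDensity_congr {D D' : ComplexConnection (4 + n) F E} {x : M}
    (h : ∀ᶠ y in 𝓝 x, ∀ σ, D.toFun σ y = D'.toFun σ y) :
    D.chernDensity Φ o x = D'.chernDensity Φ o x := by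
  simp only [chernDensity, chernForm, traceSq, curvature_congr h]

variable [FiniteDimensional ℂ F]

lemma abs_chartDensity_smul_chernDensity (D : ComplexConnection (4 + n) F E)
    (e : Trivialization F (TotalSpace.proj : TotalSpace F E → M)) [MemTrivializationAtlas e]
    {c : M} {z : EuclideanSpace ℝ (Fin (4 + n))} (hz : z ∈ localDomain (4 + n) e c) :
    |o.chartDensity c z| • D.chernDensity Φ o ((extChartAt (𝓡 (4 + n)) c).symm z) =
      (((2).factorial * (2).factorial * n.factorial : ℕ) : ℂ)⁻¹ *
        ((SignType.sign (o.chartDensity c z) : ℝ) : ℂ) *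
        alternation (fun i => EuclideanSpace.single i (1 : ℝ))
          (chernWeil (endTrace F) (D.localConnForm e c) (formInChart Φ c) z) := by
  rw [mul_right_comm, ← D.chernDensity_mul_chartDensity Φ o e hz,
    ← sign_mul_self (o.chartDensity c z), Complex.real_smul]
  push_cast
  ring

variable {D D' : ComplexConnection (4 + n) F E} {K : Set M} {c : M}

lemma chartIntegral_chernDensity_sub_eq_zero (hΦ : IsSmoothForm Φ) (hdΦ : IsClosedForm Φ)
    (e : Trivialization F (TotalSpace.proj : TotalSpace F E → M)) [MemTrivializationAtlas e]
    (hK : IsCompact K) (hKc : K ⊆ (extChartAt (𝓡 (4 + n)) c).source) (hKe : K ⊆ e.baseSet)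
    (h : ∀ x ∉ K, ∀ σ, D.toFun σ x = D'.toFun σ x)
    (hsupp : Function.support (D.chernDensity Φ o - D'.chernDensity Φ o) ⊆ K) :
    o.chartIntegral c (D.chernDensity Φ o - D'.chernDensity Φ o) = 0 := by
  have hKU : extChartAt (𝓡 (4 + n)) c '' K ⊆ localDomain (4 + n) e c := by
    rintro _ ⟨x, hx, rfl⟩
    refine ⟨(extChartAt (𝓡 (4 + n)) c).map_source (hKc hx), ?_⟩
    rw [Set.mem_preimage, (extChartAt (𝓡 (4 + n)) c).left_inv (hKc hx)]
    exact hKe hx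
  have hθ : ∀ z ∈ localDomain (4 + n) e c, z ∉ extChartAt (𝓡 (4 + n)) c '' K →
      D.localConnForm e c z = D'.localConnForm e c z := by
    intro z hz hzK
    have hx : (extChartAt (𝓡 (4 + n)) c).symm z ∉ K := fun hx =>
      hzK ⟨_, hx, (extChartAt (𝓡 (4 + n)) c).right_inv hz.1⟩
    rw [localConnForm, localConnForm, connForm_congr e (h _ hx)]
  rw [ManifoldOrientation.chartIntegral,
    setIntegral_eq_of_subset_of_forall_sdiff_eq_zero (s := localDomain (4 + n) e c)
    (isOpen_extChartAt_target c).measurableSet Set.inter_subset_left fun z hz => by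
      rw [Function.notMem_support.1 fun hzK => hz.2 ⟨hz.1, hKe (hsupp hzK)⟩, smul_zero],
    ← setIntegral_alternation_chernWeil_sub_eq_zero volume endTrace_mul_comm
      (isOpen_localDomain e c) (hK.image_of_continuousOn ((continuousOn_extChartAt c).mono hKc))
      hKU (D.contDiffOn_localConnForm e c) (D'.contDiffOn_localConnForm e c) hθ
      ((hΦ c).mono Set.inter_subset_left) (fun z hz => hdΦ c z hz.1)
      (g := fun z => (((2).factorial * (2).factorial * n.factorial : ℕ) : ℂ)⁻¹ *
        ((SignType.sign (o.chartDensity c z) : ℝ) : ℂ))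
      (fun z hz => (o.eventually_sign_chartDensity_eq hz.1).mono fun y hy => by
        rw [hy])
      (fun i => EuclideanSpace.single i (1 : ℝ))]
  refine setIntegral_congr_fun (isOpen_localDomain e c).measurableSet fun z hz => ?_
  rw [Pi.sub_apply, smul_sub, D.abs_chartDensity_smul_chernDensity e hz,
    D'.abs_chartDensity_smul_chernDensity e hz, mul_sub]

variable [CompactSpace M]

lemma integral_chernDensity_eq_of_eqOn_compl (hΦ : IsSmoothForm Φ) (hdΦ : IsClosedForm Φ)
    (e : Trivialization F (TotalSpace.proj : TotalSpace F E → M)) [MemTrivializationAtlas e]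
    (hK : IsCompact K) (hKc : K ⊆ (extChartAt (𝓡 (4 + n)) c).source) (hKe : K ⊆ e.baseSet)
    (h : ∀ x ∉ K, ∀ σ, D.toFun σ x = D'.toFun σ x) :
    o.integral (D.chernDensity Φ o) = o.integral (D'.chernDensity Φ o) := by
  have hsupp : Function.support (D.chernDensity Φ o - D'.chernDensity Φ o) ⊆ K := by
    refine Function.support_subset_iff'.2 fun x hx => sub_eq_zero.2 (chernDensity_congr ?_)
    filter_upwards [hK.isClosed.isOpen_compl.mem_nhds hx] with y hy using h y hy
  have hD := D.continuous_chernDensity o hΦ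
  have hD' := D'.continuous_chernDensity o hΦ
  rw [← sub_eq_zero, ← o.integral_sub hD hD',
    o.integral_eq_chartIntegral (hD.sub hD') hK hKc hsupp,
    chartIntegral_chernDensity_sub_eq_zero hΦ hdΦ e hK hKc hKe h hsupp]

variable (o) in
theorem integral_chernDensity_eq (hΦ : IsSmoothForm Φ) (hdΦ : IsClosedForm Φ)
    (D A : ComplexConnection (4 + n) F E) :
    o.integral (A.chernDensity Φ o) = o.integral (D.chernDensity Φ o) := by
  classical
  obtain ⟨S, ψ, hsum, hψ⟩ := exists_contMDiffMap_sum_eq_one (m := 4 + n)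
    (U := fun c : M => (extChartAt (𝓡 (4 + n)) c).source ∩ (trivializationAt F E c).baseSet)
    (fun c => (isOpen_extChartAt_source c).inter (trivializationAt F E c).open_baseSet)
    (Set.iUnion_eq_univ_iff.2 fun x => ⟨x, mem_extChartAt_source x,
      FiberBundle.mem_baseSet_trivializationAt' x⟩)
  have hpartial (T : Finset M) :
      o.integral ((interpolate D A (∑ c ∈ T, ψ c)).chernDensity Φ o) =
        o.integral (D.chernDensity Φ o) := by
    induction T using Finset.induction_on with
    | empty =>
      refine congrArg o.integral (funext fun x => chernDensity_congr (.of_forall fun y σ => ?_))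
      simp [interpolate_apply]
    | insert c T hc ih =>
      rw [← ih]
      refine integral_chernDensity_eq_of_eqOn_compl hΦ hdΦ (trivializationAt F E c)
        (isClosed_tsupport (ψ c)).isCompact ((hψ c).trans Set.inter_subset_left)
        ((hψ c).trans Set.inter_subset_right) fun x hx σ => ?_
      rw [interpolate_apply, interpolate_apply, Finset.sum_insert hc, ContMDiffMap.coe_add,
        Pi.add_apply, image_eq_zero_of_notMem_tsupport hx, zero_add]
  rw [← hpartial S, hsum]
  refine congrArg o.integral (funext fun x => chernDensity_congr (.of_forall fun y σ => ?_))
  simp [interpolate_apply]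

end ComplexConnection

end Independence

lemma alternatingMap_fin_two_eq_zero {R V W ι : Type*} [CommRing R] [AddCommGroup V] [Module R V]
    [AddCommGroup W] [Module R W] [LinearOrder ι] (b : Module.Basis ι R V)
    {α : V [⋀^Fin 2]→ₗ[R] W} (h : ∀ i j, i < j → α ![b i, b j] = 0) : α = 0 := by
  refine b.ext_alternating fun v hv => ?_
  have hne : v 0 ≠ v 1 := hv.ne zero_ne_one
  rcases lt_or_gt_of_ne hne with hlt | hgt
  · have heta : (fun i => b (v i)) = ![b (v 0), b (v 1)] := by
      ext i
      fin_cases i <;> rfl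
    rw [heta, h _ _ hlt, AlternatingMap.zero_apply]
  · have hswap : (fun i => b (v i)) ∘ Equiv.swap 0 1 = ![b (v 1), b (v 0)] := by
      ext i
      fin_cases i <;> simp
    rw [← neg_eq_iff_eq_neg.2 (α.map_swap _ zero_ne_one), hswap, h _ _ hgt, neg_zero,
      AlternatingMap.zero_apply]

section HilbertSchmidt

variable {V : Type*} [NormedAddCommGroup V] [InnerProductSpace ℂ V] [FiniteDimensional ℂ V]

lemma hsNormSq_nonneg (a : V →ₗ[ℂ] V) : 0 ≤ hsNormSq a :=
  Finset.sum_nonneg fun _ _ => sq_nonneg _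

lemma hsNormSq_eq_zero_iff {a : V →ₗ[ℂ] V} : hsNormSq a = 0 ↔ a = 0 := by
  refine ⟨fun h => (stdOrthonormalBasis ℂ V).toBasis.ext fun k => ?_,
    fun h => by simp [h, hsNormSq]⟩
  have hk := (Finset.sum_eq_zero_iff_of_nonneg fun _ _ => sq_nonneg _).1 h k (Finset.mem_univ k)
  simpa using hk

end HilbertSchmidt

section Calibrated

variable {n : ℕ} {M : Type*} [TopologicalSpace M]
  [ChartedSpace (EuclideanSpace ℝ (Fin (4 + n))) M]
  [IsManifold (𝓡 (4 + n)) ∞ M] [T2Space M]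
  {F : Type*} [NormedAddCommGroup F] [NormedSpace ℂ F] [FiniteDimensional ℂ F]
  {E : M → Type*} [TopologicalSpace (TotalSpace F E)]
  [∀ x, NormedAddCommGroup (E x)] [∀ x, InnerProductSpace ℂ (E x)]
  [FiberBundle F E] [VectorBundle ℂ F E] [VectorBundle ℝ F E]
  [ContMDiffVectorBundle ∞ F E (𝓡 (4 + n))]
  [RiemannianBundle (fun x : M => TangentSpace (𝓡 (4 + n)) x)]

namespace ComplexConnection

lemma curvatureNormSq_nonneg (D : ComplexConnection (4 + n) F E) : 0 ≤ D.curvatureNormSq :=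
  fun x => have := finiteDimensional_fiber (E := E) F x
  Finset.sum_nonneg fun _ _ => Finset.sum_nonneg fun _ _ => hsNormSq_nonneg _

lemma curvature_eq_zero_of_curvatureNormSq_eq_zero (D : ComplexConnection (4 + n) F E) {x : M}
    (h : D.curvatureNormSq x = 0) : D.curvature x = 0 := by
  have : FiniteDimensional ℂ (E x) := finiteDimensional_fiber F x
  set b := stdOrthonormalBasis ℝ (TangentSpace (𝓡 (4 + n)) x)
  have hframe (i j) (hij : i < j) : D.curvature x ![b i, b j] = 0 := by
    have hi := (Finset.sum_eq_zero_iff_of_nonneg fun i _ => Finset.sum_nonneg fun j _ =>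
      hsNormSq_nonneg _).1 h i (Finset.mem_univ i)
    exact hsNormSq_eq_zero_iff.1 <| (Finset.sum_eq_zero_iff_of_nonneg fun j _ =>
      hsNormSq_nonneg _).1 hi j (Finset.mem_Ioi.2 hij)
  obtain ⟨α, hα⟩ := D.exists_alternatingMap_eq_curvature x
  rw [← hα] at hframe ⊢
  have hα0 : α = 0 := alternatingMap_fin_two_eq_zero b.toBasis <| by
    simpa only [OrthonormalBasis.coe_toBasis] using hframe
  exact congrArg DFunLike.coe hα0

lemma isFlat_of_curvatureNormSq_eq_zero {D : ComplexConnection (4 + n) F E}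
    (h : D.curvatureNormSq = 0) : D.IsFlat := fun x =>
  congrFun (D.curvature_eq_zero_of_curvatureNormSq_eq_zero (congrFun h x))

variable {o : ManifoldOrientation (4 + n) M}
  {Φ : ∀ x : M, TangentSpace (𝓡 (4 + n)) x [⋀^Fin n]→L[ℝ] ℝ}

lemma IsCalibrated.chernDensity_eq {D : ComplexConnection (4 + n) F E} (hD : D.IsCalibrated o Φ) :
    D.chernDensity Φ o = fun x => (D.curvatureNormSq x : ℂ) :=
  funext fun x => ComplexConnection.chernDensity_eq fun v =>
    (hD.2 x v).trans (Complex.ofReal_mul _ _)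

lemma IsCalibrated.continuous_curvatureNormSq {D : ComplexConnection (4 + n) F E}
    (hD : D.IsCalibrated o Φ) (hΦ : IsSmoothForm Φ) : Continuous D.curvatureNormSq := by
  have hre := Complex.continuous_re.comp (D.continuous_chernDensity o hΦ)
  rwa [hD.chernDensity_eq] at hre

variable [CompactSpace M]

variable (o Φ) in
lemma chernNumber_eq_integral (D : ComplexConnection (4 + n) F E) :
    D.chernNumber o Φ =
      ((-(1 / (8 * Real.pi ^ 2)) : ℝ) : ℂ) * o.integral (D.chernDensity Φ o) := by
  have hconst : (1 / 2 : ℂ) * (Complex.I / (2 * Real.pi)) ^ 2 =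
      ((-(1 / (8 * Real.pi ^ 2)) : ℝ) : ℂ) := by
    rw [div_pow, Complex.I_sq]
    push_cast
    ring
  rw [← hconst, ← smul_eq_mul, ← o.integral_smul]
  refine o.integralForm_eq_integral fun x v =>
    (wedge_const_mul_left ((1 / 2 : ℂ) * (Complex.I / (2 * Real.pi)) ^ 2) _ _ v).trans ?_
  rw [Pi.smul_apply, smul_eq_mul, mul_assoc _ (D.chernDensity Φ o x),
    ← D.chernForm_eq_chernDensity_mul Φ o, chernForm]

theorem chernNumber_eq_chernNumber (hΦ : IsSmoothForm Φ) (hdΦ : IsClosedForm Φ)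
    (A D : ComplexConnection (4 + n) F E) : A.chernNumber o Φ = D.chernNumber o Φ := by
  rw [chernNumber_eq_integral, chernNumber_eq_integral, integral_chernDensity_eq o hΦ hdΦ D A]

lemma IsFlat.chernNumber_eq_zero {D : ComplexConnection (4 + n) F E} (hD : D.IsFlat) :
    D.chernNumber o Φ = 0 := by
  rw [chernNumber_eq_integral, hD.chernDensity_eq_zero, ← zero_smul ℂ (0 : M → ℂ), o.integral_smul,
    zero_smul, mul_zero]

lemma IsCalibrated.chernNumber_eq {D : ComplexConnection (4 + n) F E} (hD : D.IsCalibrated o Φ) :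
    D.chernNumber o Φ = ((-(1 / (8 * Real.pi ^ 2)) * o.integral D.curvatureNormSq : ℝ) : ℂ) := by
  rw [chernNumber_eq_integral, hD.chernDensity_eq, o.integral_ofReal, Complex.ofReal_mul]

lemma IsCalibrated.chernNumber_eq_zero_iff {D : ComplexConnection (4 + n) F E}
    (hD : D.IsCalibrated o Φ) (hΦ : IsSmoothForm Φ) : D.chernNumber o Φ = 0 ↔ D.IsFlat := by
  refine ⟨fun h => isFlat_of_curvatureNormSq_eq_zero ?_, IsFlat.chernNumber_eq_zero⟩
  have hpi : -(1 / (8 * Real.pi ^ 2)) ≠ 0 := neg_ne_zero.2 (by positivity)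
  rw [hD.chernNumber_eq, Complex.ofReal_eq_zero, mul_eq_zero, or_iff_right hpi] at h
  exact (o.integral_eq_zero_iff (hD.continuous_curvatureNormSq hΦ) D.curvatureNormSq_nonneg).1 h

end ComplexConnection

end Calibrated

end

theorem mainTheorem8_general
    {n : ℕ} {M : Type*} [TopologicalSpace M] [T2Space M] [CompactSpace M]
    [ChartedSpace (EuclideanSpace ℝ (Fin (4 + n))) M] [IsManifold (𝓡 (4 + n)) ∞ M]
    [RiemannianBundle (fun x : M => TangentSpace (𝓡 (4 + n)) x)]
    (o : ManifoldOrientation (4 + n) M)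
    {F : Type*} [NormedAddCommGroup F] [NormedSpace ℂ F] [FiniteDimensional ℂ F]
    {E : M → Type*} [TopologicalSpace (TotalSpace F E)]
    [∀ x, NormedAddCommGroup (E x)] [∀ x, InnerProductSpace ℂ (E x)]
    [FiberBundle F E] [VectorBundle ℂ F E] [VectorBundle ℝ F E]
    [ContMDiffVectorBundle ∞ F E (𝓡 (4 + n))]
    (Φ : ∀ x : M, TangentSpace (𝓡 (4 + n)) x [⋀^Fin n]→L[ℝ] ℝ)
    (hΦ : IsSmoothForm Φ) (hdΦ : IsClosedForm Φ)
    (D : ComplexConnection (4 + n) F E) (hD : D.IsCalibrated o Φ)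
    (A : ComplexConnection (4 + n) F E) :
    (A.chernNumber o Φ).im = 0 ∧ (A.chernNumber o Φ).re ≤ 0 ∧
      (A.chernNumber o Φ = 0 ↔ IsFlatBundle (4 + n) F E) ∧
      (A.chernNumber o Φ = 0 ↔ D.IsFlat) := by
  have hflat : A.chernNumber o Φ = 0 ↔ D.IsFlat := by
    rw [A.chernNumber_eq_chernNumber hΦ hdΦ D, hD.chernNumber_eq_zero_iff hΦ]
  have hreal := (A.chernNumber_eq_chernNumber hΦ hdΦ D).trans hD.chernNumber_eq
  refine ⟨?_, ?_, ⟨fun h => ⟨D, hD.1, hflat.1 h⟩, ?_⟩, hflat⟩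
  · rw [hreal, Complex.ofReal_im]
  · rw [hreal, Complex.ofReal_re]
    exact mul_nonpos_of_nonpos_of_nonneg (neg_nonpos.2 (by positivity))
      (o.integral_nonneg D.curvatureNormSq_nonneg)
  · rintro ⟨D', -, hD'⟩
    rw [A.chernNumber_eq_chernNumber hΦ hdΦ D', hD'.chernNumber_eq_zero]

theorem mainTheorem8
    -- a compact oriented Riemannian manifold `M` without boundary, of dimension `4 + n`
    {n : ℕ} {M : Type*} [TopologicalSpace M] [T2Space M] [CompactSpace M]
    [ChartedSpace (EuclideanSpace ℝ (Fin (4 + n))) M] [IsManifold (𝓡 (4 + n)) ∞ M]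
    [RiemannianBundle (fun x : M => TangentSpace (𝓡 (4 + n)) x)]
    [IsContMDiffRiemannianBundle (𝓡 (4 + n)) ∞ (EuclideanSpace ℝ (Fin (4 + n)))
      (fun x : M => TangentSpace (𝓡 (4 + n)) x)]
    (o : ManifoldOrientation (4 + n) M)
    -- a smooth Hermitian vector bundle `E` over `M`, with typical fibre `F`
    {F : Type*} [NormedAddCommGroup F] [NormedSpace ℂ F] [FiniteDimensional ℂ F]
    {E : M → Type*} [TopologicalSpace (TotalSpace F E)]
    [∀ x, NormedAddCommGroup (E x)] [∀ x, InnerProductSpace ℂ (E x)]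
    [FiberBundle F E] [VectorBundle ℂ F E] [VectorBundle ℝ F E]
    [ContMDiffVectorBundle ∞ F E (𝓡 (4 + n))] [IsSmoothHermitianBundle (4 + n) F E]
    -- a smooth closed form `Φ` of degree `n = dim M - 4` and a connection calibrated by it
    (Φ : ∀ x : M, TangentSpace (𝓡 (4 + n)) x [⋀^Fin n]→L[ℝ] ℝ)
    (hΦ : IsSmoothForm Φ) (hdΦ : IsClosedForm Φ)
    (D : ComplexConnection (4 + n) F E) (hD : D.IsCalibrated o Φ)
    -- `ch(E)` may be computed by any connection on `E`
    (A : ComplexConnection (4 + n) F E) :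
    (A.chernNumber o Φ).im = 0 ∧ (A.chernNumber o Φ).re ≤ 0 ∧
      (A.chernNumber o Φ = 0 ↔ IsFlatBundle (4 + n) F E) ∧
      (A.chernNumber o Φ = 0 ↔ D.IsFlat) :=
  mainTheorem8_general o Φ hΦ hdΦ D hD A
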